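/- All diagrams are oriented link diagrams in $\mathbb R^2$. A \emph{twisted link diagram} is a link diagram that may have virtual crossings (encircled double points without over-under information) and bars (short edges meeting an arc of the diagram transversely); a \emph{virtual link diagram} is one without bars. R-moves are the Reidemeister moves R1, R2, R3. V-moves are the virtual Reidemeister moves: V1, V2, V3 are R1, R2, R3 with all crossings virtual, and V4 moves a strand, through two virtual crossings, past a real crossing. T-moves are: (T1) a bar slides along its arc past a virtual crossing; (T2) two adjacent bars on an arc cancel; (T3) a real crossing with one bar on each of its four legs is replaced by a virtual crossing, a real crossing and a virtual crossing stacked on the same two strands, the strand that was over now being under and the sign of the crossing being unchanged. Two twisted link diagrams are equivalent as twisted links if they are related by isotopies of $\mathbb R^2$, R-, V- and T-moves; two virtual link diagrams are equivalent as virtual links if they are related, through virtual link diagrams, by isotopies of $\mathbb R^2$, R- and V-moves. A \emph{double covering diagram} of a twisted link diagram $D$ is a virtual link diagram obtained, up to isotopy of $\mathbb R^2$, as follows. Move $D$ by an isotopy of $\mathbb R^2$ into $\{x>0\}$ and into general position with respect to the height $h(x,y)=y$ (maximal and minimal points, real crossings, virtual crossings and bars lie at distinct heights, and each bar is horizontal).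 Let $s(D)$ be the mirror image of $D$ under $(x,y)\mapsto(-x,y)$ with over and under exchanged at every real crossing. In $s(D)\cup D$, for each bar of $D$, remove this bar and its mirror image, and inside a thin neighbourhood of the horizontal line containing them let the two arcs that carried them change sides, crossing each other and all arcs between them in virtual crossings only. \textbf{Theorem.} Let $D$ and $D'$ be twisted link diagrams and let $\tilde D$ and $\tilde D'$ be double covering diagrams of $D$ and $D'$. (1) If $D$ and $D'$ are equivalent as twisted links, then $\tilde D$ and $\tilde D'$ are equivalent as virtual links. (2) If $D$ and $D'$ are related by isotopies of $\mathbb R^2$, V-moves and T-moves, then $\tilde D$ and $\tilde D'$ are related by isotopies of $\mathbb R^2$ and V-moves (through virtual link diagrams). (3) If $D$ and $D'$ are related by a single R-move, then there are virtual link diagrams $F_1,F_2,F_3$ such that $\tilde D$ and $F_1$, as well as $F_3$ and $\tilde D'$, are related by isotopies of $\mathbb R^2$ and V-moves (through virtual link diagrams), and $F_1$ and $F_2$, as well as $F_2$ and $F_3$, are related by a single R-move. -/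

import Mathlib

/-!
Oriented twisted and virtual link diagrams in the plane `ℝ²`, in general position with respect to the
height function `h(x, y) = y`.

Horizontal lines cut such a diagram into regions, each of which contains exactly one minimal point,
maximal point, real crossing, virtual crossing or bar, all other strands running monotonically through
the region.  The diagram is recorded by the list of these regions, from bottom to top.  Every diagram
is isotopic in the plane to one in general position, and an isotopy of the plane is, generically,
a sequence of the height-changing events listed in `IsotopyRule`.
-/

namespace TwistedLink

/-- The direction in which an oriented strand passes a horizontal line. -/
inductive Dir where
  | up
  | down

/-- The opposite direction. -/
def Dir.flip : Dir → Dir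
  | .up => .down
  | .down => .up

theorem Dir.flip_flip (a : Dir) : a.flip.flip = a := by
  cases a <;> rfl

/-- The kind of a double point.  `slash`: real, the strand from the lower left to the upper right
is over.  `backslash`: real, the strand from the lower right to the upper left is over.
`virtual`: a virtual crossing, without over-under information. -/
inductive Kind where
  | slash
  | backslash
  | virtual

/-- Exchange over and under at a real crossing; virtual crossings stay. -/
def Kind.flip : Kind → Kind
  | .slash => .backslash
  | .backslash => .slash
  | .virtual => .virtual

/-- A double point that is a real crossing. -/
def Kind.IsReal (k : Kind) : Prop := k ≠ .virtual

/-- The elementary pieces of a diagram.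
* `cup a`: a minimal point, its left leg pointing in direction `a`, its right leg opposite;
* `cap a`: a maximal point, its left leg pointing in direction `a`, its right leg opposite;
* `cross k a b`: a double point of kind `k`; the strand from the lower left to the upper right has
  direction `a`, the strand from the lower right to the upper left has direction `b`;
* `bar a`: a bar on a strand of direction `a`. -/
inductive Gen where
  | cup (a : Dir)
  | cap (a : Dir)
  | cross (k : Kind) (a b : Dir)
  | bar (a : Dir)

/-- The strands at the bottom of an elementary piece, from left to right. -/
def Gen.dom : Gen → List Dir
  | .cup _ => []
  | .cap a => [a, a.flip]
  | .cross _ a b => [a, b]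
  | .bar a => [a]

/-- The strands at the top of an elementary piece, from left to right. -/
def Gen.cod : Gen → List Dir
  | .cup a => [a, a.flip]
  | .cap _ => []
  | .cross _ a b => [b, a]
  | .bar a => [a]

/-- A horizontal region of a diagram: one elementary piece, with vertical strands `left` to the left
of it and `right` to the right of it. -/
structure Slice where
  left : List Dir
  gen : Gen
  right : List Dir

/-- The strands on the bottom line of a region. -/
def Slice.dom (s : Slice) : List Dir := s.left ++ s.gen.dom ++ s.right

/-- The strands on the top line of a region. -/
def Slice.cod (s : Slice) : List Dir := s.left ++ s.gen.cod ++ s.right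

/-- Place a region between further vertical strands `l` on the left and `r` on the right. -/
def Slice.widen (l r : List Dir) (s : Slice) : Slice := ⟨l ++ s.left, s.gen, s.right ++ r⟩

/-- The regions, stacked from bottom to top, fit together and lead from the strands `w` to `w'`. -/
def Composable : List Dir → List Slice → List Dir → Prop
  | w, [], w' => w = w'
  | w, s :: L, w' => w = s.dom ∧ Composable s.cod L w'

theorem Composable.append {w w' w'' : List Dir} {L L' : List Slice}
    (h : Composable w L w') (h' : Composable w' L' w'') : Composable w (L ++ L') w'' := by
  induction L generalizing w with
  | nil =>
    have e : w = w' := h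
    subst e
    exact h'
  | cons s L ih => exact ⟨h.1, ih h.2⟩

/-- A twisted link diagram (oriented, in general position with respect to the height). -/
structure Diagram where
  slices : List Slice
  closed : Composable [] slices []

/-- A diagram without bars. -/
def Diagram.BarFree (D : Diagram) : Prop := ∀ s ∈ D.slices, ∀ a, s.gen ≠ Gen.bar a

/-- A virtual link diagram: a diagram without bars. -/
def VirtualDiagram : Type := {D : Diagram // D.BarFree}

/-! ### Moves -/

/-- The events of an isotopy of the plane, seen from the height function.
* `exchange`: two elementary pieces side by side exchange their heights;
* `zigzag_left`, `zigzag_right`: an adjacent pair of a maximal and a minimal point on a strand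
  appears or disappears;
* `cap_slide`, `cup_slide`: a double point passes through a maximal or minimal point of one of its
  two strands;
* `bar_cap`, `bar_cup`: a bar passes through a maximal or minimal point. -/
inductive IsotopyRule : List Slice → List Slice → Prop
  | exchange (g g' : Gen) (m : List Dir) : IsotopyRule
      [⟨[], g, m ++ g'.dom⟩, ⟨g.cod ++ m, g', []⟩]
      [⟨g.dom ++ m, g', []⟩, ⟨[], g, m ++ g'.cod⟩]
  | zigzag_left (a : Dir) : IsotopyRule
      [⟨[a], .cup a.flip, []⟩, ⟨[], .cap a, [a]⟩]
      []
  | zigzag_right (a : Dir) : IsotopyRule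
      [⟨[], .cup a, [a]⟩, ⟨[a], .cap a.flip, []⟩]
      []
  | cap_slide (k : Kind) (a b : Dir) : IsotopyRule
      [⟨[], .cross k a b, [a.flip]⟩, ⟨[b], .cap a, []⟩]
      [⟨[a], .cross k.flip b a.flip, []⟩, ⟨[], .cap a, [b]⟩]
  | cup_slide (k : Kind) (a b : Dir) : IsotopyRule
      [⟨[b], .cup a, []⟩, ⟨[], .cross k b a, [a.flip]⟩]
      [⟨[], .cup a, [b]⟩, ⟨[a], .cross k.flip a.flip b, []⟩]
  | bar_cap (a : Dir) : IsotopyRule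
      [⟨[], .bar a, [a.flip]⟩, ⟨[], .cap a, []⟩]
      [⟨[a], .bar a.flip, []⟩, ⟨[], .cap a, []⟩]
  | bar_cup (a : Dir) : IsotopyRule
      [⟨[], .cup a, []⟩, ⟨[], .bar a, [a.flip]⟩]
      [⟨[], .cup a, []⟩, ⟨[a], .bar a.flip, []⟩]

/-- Three strands of directions `a`, `b`, `c` crossing pairwise, with the crossing of `a` and `c` to
the right of `b`.  The double point of `a` and `b` has kind `kab`, and so on. -/
def triangleLeft (kab kac kbc : Kind) (a b c : Dir) : List Slice :=
  [⟨[], .cross kab a b, [c]⟩, ⟨[b], .cross kac a c, []⟩, ⟨[], .cross kbc b c, [a]⟩]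

/-- The same three strands, with the crossing of `a` and `c` to the left of `b`. -/
def triangleRight (kab kac kbc : Kind) (a b c : Dir) : List Slice :=
  [⟨[a], .cross kbc b c, []⟩, ⟨[], .cross kac a c, [b]⟩, ⟨[c], .cross kab a b, []⟩]

/-- Reidemeister moves, for all orientations.  In `r3` the three double points are real and one of
the three strands is over both others and one is under both others: the cyclic patterns "`a` over `b`
over `c` over `a`" and its reverse are excluded. -/
inductive RRule : List Slice → List Slice → Prop
  | r1 (k : Kind) (hk : k.IsReal) (a : Dir) : RRule
      [⟨[], .cross k a a.flip, []⟩, ⟨[], .cap a.flip, []⟩]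
      [⟨[], .cap a, []⟩]
  | r2 (k : Kind) (hk : k.IsReal) (a b : Dir) : RRule
      [⟨[], .cross k a b, []⟩, ⟨[], .cross k.flip b a, []⟩]
      []
  | r3 (kab kac kbc : Kind) (hab : kab.IsReal) (hac : kac.IsReal) (hbc : kbc.IsReal)
      (h : kab = kbc → kac = kab) (a b c : Dir) : RRule
      (triangleLeft kab kac kbc a b c) (triangleRight kab kac kbc a b c)

/-- Virtual Reidemeister moves, for all orientations.  In `v4` exactly one of the three double points
is real. -/
inductive VRule : List Slice → List Slice → Prop
  | v1 (a : Dir) : VRule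
      [⟨[], .cross .virtual a a.flip, []⟩, ⟨[], .cap a.flip, []⟩]
      [⟨[], .cap a, []⟩]
  | v2 (a b : Dir) : VRule
      [⟨[], .cross .virtual a b, []⟩, ⟨[], .cross .virtual b a, []⟩]
      []
  | v3 (a b c : Dir) : VRule
      (triangleLeft .virtual .virtual .virtual a b c)
      (triangleRight .virtual .virtual .virtual a b c)
  | v4_ab (k : Kind) (hk : k.IsReal) (a b c : Dir) : VRule
      (triangleLeft k .virtual .virtual a b c) (triangleRight k .virtual .virtual a b c)
  | v4_ac (k : Kind) (hk : k.IsReal) (a b c : Dir) : VRule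
      (triangleLeft .virtual k .virtual a b c) (triangleRight .virtual k .virtual a b c)
  | v4_bc (k : Kind) (hk : k.IsReal) (a b c : Dir) : VRule
      (triangleLeft .virtual .virtual k a b c) (triangleRight .virtual .virtual k a b c)

/-- Twisted Reidemeister moves, for all orientations.
* `t1_left`, `t1_right`: a bar passes a virtual crossing;
* `t2`: two neighbouring bars cancel;
* `t3`: a real crossing with a bar on each of its four legs is replaced by a real crossing between
  two virtual crossings. -/
inductive TRule : List Slice → List Slice → Prop
  | t1_left (a b : Dir) : TRule
      [⟨[], .bar a, [b]⟩, ⟨[], .cross .virtual a b, []⟩]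
      [⟨[], .cross .virtual a b, []⟩, ⟨[b], .bar a, []⟩]
  | t1_right (a b : Dir) : TRule
      [⟨[a], .bar b, []⟩, ⟨[], .cross .virtual a b, []⟩]
      [⟨[], .cross .virtual a b, []⟩, ⟨[], .bar b, [a]⟩]
  | t2 (a : Dir) : TRule
      [⟨[], .bar a, []⟩, ⟨[], .bar a, []⟩]
      []
  | t3 (k : Kind) (hk : k.IsReal) (a b : Dir) : TRule
      [⟨[], .bar a, [b]⟩, ⟨[a], .bar b, []⟩, ⟨[], .cross k a b, []⟩,
        ⟨[], .bar b, [a]⟩, ⟨[b], .bar a, []⟩]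
      [⟨[], .cross .virtual a b, []⟩, ⟨[], .cross k b a, []⟩, ⟨[], .cross .virtual a b, []⟩]

/-- `D'` arises from `D` by replacing, inside a disk, a left-hand side of a rule by the right-hand
side. -/
def Step (rule : List Slice → List Slice → Prop) (D D' : Diagram) : Prop :=
  ∃ (P Q L L' : List Slice) (l r : List Dir), rule L L' ∧
    D.slices = P ++ L.map (Slice.widen l r) ++ Q ∧
    D'.slices = P ++ L'.map (Slice.widen l r) ++ Q

/-- Twisted link diagrams that are isotopic in the plane. -/
def Isotopic : Diagram → Diagram → Prop :=
  Relation.EqvGen (Step IsotopyRule)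

/-- Twisted link diagrams related by isotopies of the plane, V-moves and T-moves. -/
def VTRelated : Diagram → Diagram → Prop :=
  Relation.EqvGen fun D D' => Step IsotopyRule D D' ∨ Step VRule D D' ∨ Step TRule D D'

/-- Twisted link diagrams that are equivalent as twisted links: related by isotopies of the plane,
R-moves, V-moves and T-moves. -/
def TwistedEquiv : Diagram → Diagram → Prop :=
  Relation.EqvGen fun D D' =>
    Step IsotopyRule D D' ∨ Step RRule D D' ∨ Step VRule D D' ∨ Step TRule D D'

/-- One diagram is obtained from the other by a single R-move. -/
def RMove (D D' : Diagram) : Prop := Step RRule D D' ∨ Step RRule D' D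

/-- Virtual link diagrams that are isotopic in the plane. -/
def VirtualIsotopic : VirtualDiagram → VirtualDiagram → Prop :=
  Relation.EqvGen fun E E' => Step IsotopyRule E.1 E'.1

/-- Virtual link diagrams related by isotopies of the plane and V-moves. -/
def VRelated : VirtualDiagram → VirtualDiagram → Prop :=
  Relation.EqvGen fun E E' => Step IsotopyRule E.1 E'.1 ∨ Step VRule E.1 E'.1

/-- Virtual link diagrams that are equivalent as virtual links: related by isotopies of the plane,
R-moves and V-moves. -/
def VirtualEquiv : VirtualDiagram → VirtualDiagram → Prop :=
  Relation.EqvGen fun E E' =>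
    Step IsotopyRule E.1 E'.1 ∨ Step RRule E.1 E'.1 ∨ Step VRule E.1 E'.1

/-! ### Double covering diagrams -/

/-- The reflection `r : (x, y) ↦ (-x, y)` on elementary pieces. -/
def Gen.reflect : Gen → Gen
  | .cup a => .cup a.flip
  | .cap a => .cap a.flip
  | .cross k a b => .cross k.flip b a
  | .bar a => .bar a

/-- The change `c` of the over-under information of every real crossing. -/
def Gen.switch : Gen → Gen
  | .cross k a b => .cross k.flip a b
  | g => g

/-- The composition `s = c ∘ r`. -/
def Gen.mirror (g : Gen) : Gen := g.reflect.switch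

theorem Gen.dom_mirror (g : Gen) : g.mirror.dom = g.dom.reverse := by
  cases g <;> simp [Gen.mirror, Gen.reflect, Gen.switch, Gen.dom, Dir.flip_flip]

theorem Gen.cod_mirror (g : Gen) : g.mirror.cod = g.cod.reverse := by
  cases g <;> simp [Gen.mirror, Gen.reflect, Gen.switch, Gen.cod, Dir.flip_flip]

/-- A strand of direction `a` moves to the right through virtual crossings with the strands `m`,
between strands `l` and `r`. -/
def passRight (l : List Dir) (a : Dir) : List Dir → List Dir → List Slice
  | [], _ => []
  | b :: m, r => ⟨l, .cross .virtual a b, m ++ r⟩ :: passRight (l ++ [b]) a m r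

/-- A strand of direction `a` moves to the left through virtual crossings with the strands `m`,
between strands `l` and `r`. -/
def passLeft (l : List Dir) (a : Dir) : List Dir → List Dir → List Slice
  | [], _ => []
  | b :: m, r => passLeft (l ++ [b]) a m r ++ [⟨l, .cross .virtual b a, m ++ r⟩]

/-- The replacement at the level of a bar.  The bar lies on a strand of direction `a` of `D`, with
strands `l` of `D` to its left and `r` to its right; its mirror image lies on a strand of `s(D)`.
Both bars are removed, and the two strands that carried them change sides: both run to
the axis of reflection, cross each other there, and continue, all their crossings (with each other and
with the strands in between) being virtual. -/
def barBlock (l : List Dir) (a : Dir) (r : List Dir) : List Slice :=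
  passRight r.reverse a l.reverse (l ++ a :: r)
    ++ passLeft (r.reverse ++ l.reverse ++ [a]) a l r
    ++ [⟨r.reverse ++ l.reverse, .cross .virtual a a, l ++ r⟩]
    ++ passLeft r.reverse a l.reverse (a :: l ++ r)
    ++ passRight (r.reverse ++ a :: l.reverse) a l r

/-- The part of the double covering diagram over a region of `D`.  The mirror image `s(D)` is on the
left of `D`.  A region without bar contributes its mirror image and itself; a region with a bar is
replaced by `barBlock`. -/
def Slice.double : Slice → List Slice
  | ⟨l, .bar a, r⟩ => barBlock l a r
  | ⟨l, g, r⟩ =>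
    [⟨r.reverse, g.mirror, l.reverse ++ l ++ g.dom ++ r⟩,
      ⟨r.reverse ++ g.mirror.cod ++ l.reverse ++ l, g, r⟩]

theorem composable_passRight (l : List Dir) (a : Dir) (m r : List Dir) :
    Composable (l ++ a :: m ++ r) (passRight l a m r) (l ++ m ++ a :: r) := by
  induction m generalizing l with
  | nil => simp [passRight, Composable]
  | cons b m ih =>
    rw [passRight]
    refine ⟨by simp [Slice.dom, Gen.dom], ?_⟩
    simpa [Slice.cod, Gen.cod] using ih (l ++ [b])

theorem composable_passLeft (l : List Dir) (a : Dir) (m r : List Dir) :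
    Composable (l ++ m ++ a :: r) (passLeft l a m r) (l ++ a :: m ++ r) := by
  induction m generalizing l with
  | nil => simp [passLeft, Composable]
  | cons b m ih =>
    rw [passLeft]
    have h := ih (l ++ [b])
    simp only [List.append_assoc, List.cons_append, List.nil_append] at h
    simp only [List.append_assoc, List.cons_append]
    exact h.append (by simp [Composable, Slice.dom, Slice.cod, Gen.dom, Gen.cod])

theorem composable_barBlock (l : List Dir) (a : Dir) (r : List Dir) :
    Composable (r.reverse ++ a :: l.reverse ++ l ++ a :: r) (barBlock l a r)
      (r.reverse ++ a :: l.reverse ++ l ++ a :: r) := by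
  have h1 := composable_passRight r.reverse a l.reverse (l ++ a :: r)
  have h2 := composable_passLeft (r.reverse ++ l.reverse ++ [a]) a l r
  have h3 := composable_passLeft r.reverse a l.reverse (a :: l ++ r)
  have h4 := composable_passRight (r.reverse ++ a :: l.reverse) a l r
  simp only [List.append_assoc, List.cons_append, List.nil_append] at h1 h2 h3 h4
  have h5 : Composable (r.reverse ++ (l.reverse ++ a :: a :: (l ++ r)))
      [⟨r.reverse ++ l.reverse, .cross .virtual a a, l ++ r⟩]
      (r.reverse ++ (l.reverse ++ a :: a :: (l ++ r))) := by
    simp [Composable, Slice.dom, Slice.cod, Gen.dom, Gen.cod]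
  have h := (((h1.append h2).append h5).append h3).append h4
  simpa [barBlock] using h

theorem Slice.composable_double (s : Slice) :
    Composable (s.dom.reverse ++ s.dom) s.double (s.cod.reverse ++ s.cod) := by
  rcases s with ⟨l, g, r⟩
  cases g with
  | bar a =>
    have h := composable_barBlock l a r
    simpa [Slice.dom, Slice.cod, Gen.dom, Gen.cod, Slice.double] using h
  | _ =>
    simp [Slice.dom, Slice.cod, Slice.double, Composable, Gen.dom_mirror, Gen.cod_mirror]

theorem composable_double {w w' : List Dir} {L : List Slice} (h : Composable w L w') :
    Composable (w.reverse ++ w) (L.flatMap Slice.double) (w'.reverse ++ w') := by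
  induction L generalizing w with
  | nil =>
    have e : w = w' := h
    subst e
    exact rfl
  | cons s L ih =>
    have h1 : w = s.dom := h.1
    subst h1
    rw [List.flatMap_cons]
    exact s.composable_double.append (ih h.2)

theorem barFree_passRight (l : List Dir) (a : Dir) (m r : List Dir) :
    ∀ s ∈ passRight l a m r, ∀ c, s.gen ≠ Gen.bar c := by
  induction m generalizing l with
  | nil => simp [passRight]
  | cons b m ih =>
    rw [passRight]
    intro s hs c
    rcases List.mem_cons.1 hs with rfl | hs
    · simp
    · exact ih _ s hs c

theorem barFree_passLeft (l : List Dir) (a : Dir) (m r : List Dir) :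
    ∀ s ∈ passLeft l a m r, ∀ c, s.gen ≠ Gen.bar c := by
  induction m generalizing l with
  | nil => simp [passLeft]
  | cons b m ih =>
    rw [passLeft]
    intro s hs c
    rcases List.mem_append.1 hs with hs | hs
    · exact ih _ s hs c
    · rw [List.mem_singleton.1 hs]
      simp

theorem Slice.barFree_double (t : Slice) : ∀ s ∈ t.double, ∀ c, s.gen ≠ Gen.bar c := by
  rcases t with ⟨l, g, r⟩
  cases g with
  | bar a =>
    intro s hs c
    simp only [Slice.double, barBlock, List.mem_append, List.mem_singleton] at hs
    rcases hs with (((hs | hs) | hs) | hs) | hs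
    · exact barFree_passRight _ _ _ _ s hs c
    · exact barFree_passLeft _ _ _ _ s hs c
    · rw [hs]
      simp
    · exact barFree_passLeft _ _ _ _ s hs c
    · exact barFree_passRight _ _ _ _ s hs c
  | _ =>
    intro s hs c
    simp only [Slice.double, List.mem_cons, List.not_mem_nil, or_false] at hs
    rcases hs with rfl | rfl <;> simp [Gen.mirror, Gen.reflect, Gen.switch]

/-- The virtual link diagram obtained from `s(D) ∪ D`, with `D` in the half-plane `x > 0`, by
the replacement at the level of each bar. -/
def Diagram.double (D : Diagram) : VirtualDiagram :=
  ⟨⟨D.slices.flatMap Slice.double, composable_double D.closed⟩, by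
    intro s hs c
    obtain ⟨t, -, h⟩ := List.mem_flatMap.1 hs
    exact t.barFree_double s h c⟩

/-- `E` is a double covering diagram of `D`: it is (up to isotopy of the plane) obtained by the
doubling construction from a diagram in general position that is isotopic to `D`. -/
def IsDoubleCoveringDiagram (D : Diagram) (E : VirtualDiagram) : Prop :=
  ∃ D₁ : Diagram, Isotopic D D₁ ∧ VirtualIsotopic E D₁.double

end TwistedLink

/-!
The double covering diagram of a stack of regions of `D` is again a stack of regions, and doubling
is compatible with stacking. It therefore suffices to treat the two sides of a single local move,
with arbitrary vertical strands `l` and `r` beside it: `Cov` says that the doubles of two stacks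
are related by isotopies and V-moves (`VEq`), and `CovRule X Y` that this holds for the local move
from `X` to `Y` in all contexts.

For stacks `X` without bars, the double is the mirror image of `X` beside `X` (`double_of_noBar`),
since pieces side by side exchange their heights (`interchange`). The mirror image of a rule is a
rule (`IsotopyRule.mirror`, `VRule.mirror`, `RRule.mirror`), so each bar-free isotopy event or
V-move is covered by two copies of itself, and an R-move by two R-moves (`Step.rMove_double`).

A bar is covered by a virtual braid in which its strand and the mirror image of this strand change
sides. The key observation is `barBlock_snoc`: if `b` is the strand next to the bar on the left,
this braid is, up to exchanges of height, the double of the diagram in which `b` first crosses the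
strand of the bar virtually, then the bar is passed, then `b` crosses back. This gives T1 and T2
at once, and it reduces a bar in any position to a bar on the leftmost strand, whose double is a
single virtual crossing on the axis (`Cov.bar_conj`).

A piece to the right of a bar exchanges its height with the bar because the braid stays between
that piece and its mirror image (`Exch.bar_left`). A piece to the left of a bar is first moved to
the right of its strand, a strand passing any piece by virtual crossings (`natural_stack`,
`Exch.bar_right`). The same naturality, now also for bars, moves all strands on the left of a
local move out of the way, so that a move need only be covered in a diagram without further
strands (`CovRule.of_veq`). There remain explicit computations with four strands: two bars
exchange their heights (`barBlock_barBlock`), T3 (`barBlock_cross_barBlock`), both of which rest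
on the naturality of the virtual braid `blockSwap`, and a bar at a maximal point
(`CovRule.bar_cap`). A bar at a minimal point is moved along a zigzag to a maximal point
(`CovRule.bar_cup`).
-/

namespace TwistedLink

/-! ### Stacks of regions up to isotopies and V-moves -/

theorem Slice.dom_widen (l r : List Dir) (s : Slice) : (s.widen l r).dom = l ++ s.dom ++ r := by
  simp [Slice.dom, Slice.widen]

theorem Slice.cod_widen (l r : List Dir) (s : Slice) : (s.widen l r).cod = l ++ s.cod ++ r := by
  simp [Slice.cod, Slice.widen]

theorem Slice.widen_widen (l r l' r' : List Dir) (s : Slice) :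
    (s.widen l' r').widen l r = s.widen (l ++ l') (r' ++ r) := by
  simp [Slice.widen]

/-- Place a stack of regions between further vertical strands. -/
abbrev wide (l r : List Dir) (L : List Slice) : List Slice := L.map (Slice.widen l r)

theorem wide_nil_nil (L : List Slice) : wide [] [] L = L := by
  have : Slice.widen [] [] = id := by
    funext s
    simp [Slice.widen]
  rw [wide, this, List.map_id]

theorem wide_wide (l r l' r' : List Dir) (L : List Slice) :
    wide l r (wide l' r' L) = wide (l ++ l') (r' ++ r) L := by
  simp [wide, Slice.widen_widen]

theorem composable_append_iff {w w'' : List Dir} {L M : List Slice} :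
    Composable w (L ++ M) w'' ↔ ∃ w', Composable w L w' ∧ Composable w' M w'' := by
  induction L generalizing w with
  | nil => simp [Composable]
  | cons s L ih => simp [Composable, ih, and_assoc]

theorem Composable.wide {w w' : List Dir} {L : List Slice} (h : Composable w L w')
    (l r : List Dir) : Composable (l ++ w ++ r) (wide l r L) (l ++ w' ++ r) := by
  induction L generalizing w with
  | nil => simp_all [Composable]
  | cons s L ih =>
    refine ⟨by rw [Slice.dom_widen, h.1], ?_⟩
    rw [Slice.cod_widen]
    exact ih h.2

theorem Composable.cod_unique {w w' w'' : List Dir} {L : List Slice} (h : Composable w L w')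
    (h' : Composable w L w'') : w' = w'' := by
  induction L generalizing w with
  | nil => exact h.symm.trans h'
  | cons s L ih => exact ih h.2 h'.2

theorem Composable.dom_unique {u w w' w'' : List Dir} {L : List Slice} (hL : L ≠ [])
    (h : Composable u L w') (h' : Composable w L w'') : u = w := by
  cases L with
  | nil => exact absurd rfl hL
  | cons s L => exact h.1.trans h'.1.symm

/-- A stack of regions inside a larger stack: the types of the parts are determined by it. -/
theorem Composable.split {w w' u v : List Dir} {P X Q : List Slice} (hX : X ≠ [])
    (hu : Composable u X v) (h : Composable w (P ++ X ++ Q) w') :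
    Composable w P u ∧ Composable v Q w' := by
  obtain ⟨a, h, hQ⟩ := composable_append_iff.1 h
  obtain ⟨b, hP, h⟩ := composable_append_iff.1 h
  obtain rfl := Composable.dom_unique hX h hu
  obtain rfl := h.cod_unique hu
  exact ⟨hP, hQ⟩

/-- The two sides of a local move lead from the same strands to the same strands, and the left side
is not empty. -/
def WellTyped (X Y : List Slice) : Prop :=
  X ≠ [] ∧ ∃ u v, Composable u X v ∧ Composable u Y v

section

attribute [local simp] Composable Slice.dom Slice.cod Gen.dom Gen.cod Dir.flip_flip triangleLeft
  triangleRight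

theorem IsotopyRule.wellTyped {X Y : List Slice} (h : IsotopyRule X Y) : WellTyped X Y := by
  cases h with
  | exchange g g' m => exact ⟨by simp, g.dom ++ m ++ g'.dom, g.cod ++ m ++ g'.cod, by simp, by simp⟩
  | zigzag_left a => exact ⟨by simp, [a], [a], by simp, by simp⟩
  | zigzag_right a => exact ⟨by simp, [a], [a], by simp, by simp⟩
  | cap_slide k a b => exact ⟨by simp, [a, b, a.flip], [b], by simp, by simp⟩
  | cup_slide k a b => exact ⟨by simp, [b], [a, b, a.flip], by simp, by simp⟩
  | bar_cap a => exact ⟨by simp, [a, a.flip], [], by simp, by simp⟩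
  | bar_cup a => exact ⟨by simp, [], [a, a.flip], by simp, by simp⟩

theorem RRule.wellTyped {X Y : List Slice} (h : RRule X Y) : WellTyped X Y := by
  cases h with
  | r1 k hk a => exact ⟨by simp, [a, a.flip], [], by simp, by simp⟩
  | r2 k hk a b => exact ⟨by simp, [a, b], [a, b], by simp, by simp⟩
  | r3 kab kac kbc hab hac hbc h a b c => exact ⟨by simp, [a, b, c], [c, b, a], by simp, by simp⟩

theorem VRule.wellTyped {X Y : List Slice} (h : VRule X Y) : WellTyped X Y := by
  cases h with
  | v1 a => exact ⟨by simp, [a, a.flip], [], by simp, by simp⟩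
  | v2 a b => exact ⟨by simp, [a, b], [a, b], by simp, by simp⟩
  | v3 a b c => exact ⟨by simp, [a, b, c], [c, b, a], by simp, by simp⟩
  | v4_ab k hk a b c => exact ⟨by simp, [a, b, c], [c, b, a], by simp, by simp⟩
  | v4_ac k hk a b c => exact ⟨by simp, [a, b, c], [c, b, a], by simp, by simp⟩
  | v4_bc k hk a b c => exact ⟨by simp, [a, b, c], [c, b, a], by simp, by simp⟩

theorem TRule.wellTyped {X Y : List Slice} (h : TRule X Y) : WellTyped X Y := by
  cases h with
  | t1_left a b => exact ⟨by simp, [a, b], [b, a], by simp, by simp⟩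
  | t1_right a b => exact ⟨by simp, [a, b], [b, a], by simp, by simp⟩
  | t2 a => exact ⟨by simp, [a], [a], by simp, by simp⟩
  | t3 k hk a b => exact ⟨by simp, [a, b], [b, a], by simp, by simp⟩

end

/-- No region contains a bar. -/
def NoBar (L : List Slice) : Prop := ∀ s ∈ L, ∀ a, s.gen ≠ Gen.bar a

theorem noBar_append {L M : List Slice} : NoBar (L ++ M) ↔ NoBar L ∧ NoBar M := by
  simp only [NoBar, List.mem_append]
  exact ⟨fun h => ⟨fun s hs => h s (.inl hs), fun s hs => h s (.inr hs)⟩,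
    fun h s hs => hs.elim (h.1 s) (h.2 s)⟩

theorem noBar_wide {l r : List Dir} {L : List Slice} : NoBar (wide l r L) ↔ NoBar L := by
  simp [NoBar, wide, Slice.widen]

/-- Stacks of regions from `w` to `w'` related by isotopies and V-moves: the congruence generated by
these moves. -/
inductive VEq : List Dir → List Dir → List Slice → List Slice → Prop
  | refl {w w' : List Dir} {L : List Slice} (h : Composable w L w') : VEq w w' L L
  | symm {w w' : List Dir} {L M : List Slice} (h : VEq w w' L M) : VEq w w' M L
  | trans {w w' : List Dir} {L M N : List Slice} (h : VEq w w' L M) (h' : VEq w w' M N) :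
      VEq w w' L N
  | comp {w w' w'' : List Dir} {L L' M M' : List Slice} (h : VEq w w' L L')
      (h' : VEq w' w'' M M') : VEq w w'' (L ++ M) (L' ++ M')
  | rule {u v : List Dir} {X Y : List Slice} (l r : List Dir) (h : IsotopyRule X Y ∨ VRule X Y)
      (hX : Composable u X v) (hY : Composable u Y v) :
      VEq (l ++ u ++ r) (l ++ v ++ r) (wide l r X) (wide l r Y)

theorem VEq.composable {w w' : List Dir} {L M : List Slice} (h : VEq w w' L M) :
    Composable w L w' ∧ Composable w M w' := by
  induction h with
  | refl h => exact ⟨h, h⟩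
  | symm _ ih => exact ih.symm
  | trans _ _ ih ih' => exact ⟨ih.1, ih'.2⟩
  | comp _ _ ih ih' => exact ⟨ih.1.append ih'.1, ih.2.append ih'.2⟩
  | rule l r _ hX hY => exact ⟨hX.wide l r, hY.wide l r⟩

/-- No isotopy event and no V-move creates or removes bars, so the intermediate stacks of a relation
between stacks without bars have no bars either. -/
theorem VEq.noBar_iff {w w' : List Dir} {L M : List Slice} (h : VEq w w' L M) :
    NoBar L ↔ NoBar M := by
  induction h with
  | refl h => rfl
  | symm _ ih => exact ih.symm
  | trans _ _ ih ih' => exact ih.trans ih'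
  | comp _ _ ih ih' => rw [noBar_append, noBar_append, ih, ih']
  | rule l r h _ _ =>
    rw [noBar_wide, noBar_wide]
    rcases h with h | h <;> cases h <;> simp [NoBar, triangleLeft, triangleRight, and_comm]

theorem VEq.widen {w w' : List Dir} {L M : List Slice} (h : VEq w w' L M) (l r : List Dir) :
    VEq (l ++ w ++ r) (l ++ w' ++ r) (wide l r L) (wide l r M) := by
  induction h with
  | refl h => exact .refl (h.wide l r)
  | symm _ ih => exact ih.symm
  | trans _ _ ih ih' => exact ih.trans ih'
  | comp _ _ ih ih' =>
    simp only [wide, List.map_append]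
    exact ih.comp ih'
  | rule l' r' h hX hY =>
    rw [wide_wide, wide_wide]
    simpa using VEq.rule (l ++ l') (r' ++ r) h hX hY

/-- Related stacks may be exchanged inside a larger stack. -/
theorem VEq.context {w w' u v : List Dir} {A B : List Slice} (h : VEq u v A B) (hA : A ≠ [])
    {P Q : List Slice} (hc : Composable w (P ++ A ++ Q) w') :
    VEq w w' (P ++ A ++ Q) (P ++ B ++ Q) := by
  obtain ⟨hP, hQ⟩ := Composable.split hA h.composable.1 hc
  exact ((VEq.refl hP).comp h).comp (.refl hQ)

/-- Related stacks inside a closed diagram without bars give related virtual link diagrams. -/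
theorem VEq.vRelated {w w' : List Dir} {L M : List Slice} (h : VEq w w' L M) {P Q : List Slice}
    (hP : Composable [] P w) (hQ : Composable w' Q []) {E E' : VirtualDiagram}
    (hE : E.1.slices = P ++ L ++ Q) (hE' : E'.1.slices = P ++ M ++ Q) : VRelated E E' := by
  induction h generalizing P Q E E' with
  | refl h =>
    have : E = E' := by
      rcases E with ⟨⟨_, _⟩, _⟩
      rcases E' with ⟨⟨_, _⟩, _⟩
      obtain rfl := hE
      obtain rfl := hE'
      rfl
    rw [this]
    exact .refl _
  | symm _ ih => exact .symm _ _ (ih hP hQ hE' hE)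
  | @trans w w' L M N h h' ih ih' =>
    have hb : NoBar (P ++ M ++ Q) := by
      have := E.2
      rw [Diagram.BarFree, hE] at this
      change NoBar _ at this
      rw [noBar_append, noBar_append] at this ⊢
      exact ⟨⟨this.1.1, h.noBar_iff.1 this.1.2⟩, this.2⟩
    exact .trans _ ⟨⟨P ++ M ++ Q, (hP.append h.composable.2).append hQ⟩, hb⟩ _
      (ih hP hQ hE rfl) (ih' hP hQ rfl hE')
  | @comp w w' w'' L L' M M' h h' ih ih' =>
    have hb : NoBar (P ++ L' ++ (M ++ Q)) := by
      have := E.2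
      rw [Diagram.BarFree, hE] at this
      change NoBar _ at this
      simp only [noBar_append] at this ⊢
      exact ⟨⟨this.1.1, h.noBar_iff.1 this.1.2.1⟩, this.1.2.2, this.2⟩
    have hQ' := h'.composable.1.append hQ
    have hP' := hP.append h.composable.2
    exact .trans _ ⟨⟨P ++ L' ++ (M ++ Q), hP'.append hQ'⟩, hb⟩ _
      (ih hP hQ' (by simpa using hE) rfl) (ih' hP' hQ (by simp) (by simpa using hE'))
  | @rule u v X Y l r h hX hY =>
    exact .rel _ _ (h.imp (fun h => ⟨P, Q, X, Y, l, r, h, hE, hE'⟩)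
      fun h => ⟨P, Q, X, Y, l, r, h, hE, hE'⟩)

theorem interchange_slice (s t : Slice) :
    VEq (s.dom ++ t.dom) (s.cod ++ t.cod) [s.widen [] t.dom, t.widen s.cod []]
      [t.widen s.dom [], s.widen [] t.cod] := by
  rcases s with ⟨l, g, m⟩
  rcases t with ⟨m', g', r⟩
  have h := VEq.rule l r (.inl (IsotopyRule.exchange g g' (m ++ m')))
    (u := g.dom ++ (m ++ m') ++ g'.dom) (v := g.cod ++ (m ++ m') ++ g'.cod)
    (by simp [Composable, Slice.dom, Slice.cod]) (by simp [Composable, Slice.dom, Slice.cod])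
  simpa [Slice.dom, Slice.cod, Slice.widen, wide] using h

/-- Stacks of regions side by side exchange their heights. -/
theorem interchange {u v u' v' : List Dir} {X Y : List Slice} (hX : Composable u X v)
    (hY : Composable u' Y v') :
    VEq (u ++ u') (v ++ v') (wide [] u' X ++ wide v [] Y) (wide u [] Y ++ wide [] v' X) := by
  have single : ∀ (s : Slice) {u' v' : List Dir} {Y : List Slice}, Composable u' Y v' →
      VEq (s.dom ++ u') (s.cod ++ v') (s.widen [] u' :: wide s.cod [] Y)
        (wide s.dom [] Y ++ [s.widen [] v']) := by
    intro s u' v' Y hY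
    induction Y generalizing u' with
    | nil =>
      obtain rfl : u' = v' := hY
      exact .refl (by simp [Composable, Slice.dom_widen, Slice.cod_widen])
    | cons t Y ih =>
      obtain ⟨rfl, hY⟩ := hY
      have h1 := (interchange_slice s t).comp (.refl (by simpa using hY.wide s.cod []))
      have h2 : Composable (s.dom ++ t.dom) [t.widen s.dom []] (s.dom ++ t.cod) := by
        simp [Composable, Slice.dom_widen, Slice.cod_widen]
      exact h1.trans ((VEq.refl h2).comp (ih hY))
  induction X generalizing u with
  | nil =>
    obtain rfl : u = v := hX
    simpa [wide] using VEq.refl (hY.wide u [])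
  | cons s X ih =>
    obtain ⟨rfl, hX⟩ := hX
    have h2 : Composable (s.dom ++ u') [s.widen [] u'] (s.cod ++ u') := by
      simp [Composable, Slice.dom_widen, Slice.cod_widen]
    refine ((VEq.refl h2).comp (ih hX)).trans ?_
    have h3 := (single s hY).comp (VEq.refl (by simpa using hX.wide [] v'))
    simpa [wide] using h3

/-! ### Doubling without bars -/

/-- The mirror image `s` of a region: left and right are exchanged. -/
def Slice.mirror (s : Slice) : Slice := ⟨s.right.reverse, s.gen.mirror, s.left.reverse⟩

/-- The mirror image `s` of a stack of regions. -/
abbrev mirrorStack (X : List Slice) : List Slice := X.map Slice.mirror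

theorem Slice.dom_mirror (s : Slice) : s.mirror.dom = s.dom.reverse := by
  simp [Slice.mirror, Slice.dom, Gen.dom_mirror]

theorem Slice.cod_mirror (s : Slice) : s.mirror.cod = s.cod.reverse := by
  simp [Slice.mirror, Slice.cod, Gen.cod_mirror]

theorem mirrorStack_wide (l r : List Dir) (X : List Slice) :
    mirrorStack (wide l r X) = wide r.reverse l.reverse (mirrorStack X) := by
  simp [mirrorStack, wide, Slice.mirror, Slice.widen]

theorem Composable.mirror {u v : List Dir} {X : List Slice} (h : Composable u X v) :
    Composable u.reverse (mirrorStack X) v.reverse := by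
  induction X generalizing u with
  | nil => exact congrArg List.reverse h
  | cons s X ih =>
    refine ⟨by rw [Slice.dom_mirror, h.1], ?_⟩
    rw [Slice.cod_mirror]
    exact ih h.2

theorem Slice.double_of_noBar {s : Slice} (h : ∀ a, s.gen ≠ Gen.bar a) :
    s.double = [s.mirror.widen [] s.dom, s.widen s.cod.reverse []] := by
  rcases s with ⟨l, g, r⟩
  cases g with
  | bar a => exact absurd rfl (h a)
  | _ => simp [Slice.double, Slice.mirror, Slice.widen, Slice.dom, Slice.cod, Gen.cod_mirror]

/-- Over a stack without bars, the double covering diagram is the mirror image followed by the stack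
itself, side by side. -/
theorem double_of_noBar {u v : List Dir} {X : List Slice} (hb : NoBar X) (h : Composable u X v) :
    VEq (u.reverse ++ u) (v.reverse ++ v) (X.flatMap Slice.double)
      (wide [] u (mirrorStack X) ++ wide v.reverse [] X) := by
  induction X generalizing u with
  | nil =>
    obtain rfl : u = v := h
    exact .refl rfl
  | cons s X ih =>
    obtain ⟨rfl, h⟩ := h
    have hs : ∀ a, s.gen ≠ Gen.bar a := hb s (by simp)
    have ih := ih (fun t ht => hb t (by simp [ht])) h
    have h1 := s.composable_double
    rw [List.flatMap_cons]
    refine ((VEq.refl h1).comp ih).trans ?_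
    rw [Slice.double_of_noBar hs]
    have hs' : Composable s.dom [s] s.cod := ⟨rfl, rfl⟩
    have h2 := interchange h.mirror hs'
    have h3 : Composable (s.dom.reverse ++ s.dom) [s.mirror.widen [] s.dom]
        (s.cod.reverse ++ s.dom) := by
      simp [Composable, Slice.dom_widen, Slice.cod_widen, Slice.dom_mirror, Slice.cod_mirror]
    have h4 := ((VEq.refl h3).comp h2.symm).comp
      (VEq.refl (by simpa using h.wide v.reverse []))
    simpa [wide] using h4

section

attribute [local simp] Slice.mirror Gen.mirror Gen.reflect Gen.switch Dir.flip_flip triangleLeft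
  triangleRight Gen.dom_mirror Gen.cod_mirror

theorem Kind.flip_flip (k : Kind) : k.flip.flip = k := by
  cases k <;> rfl

theorem Kind.flip_virtual : Kind.virtual.flip = .virtual := rfl

attribute [local simp] Kind.flip_flip Kind.flip_virtual

/-- The mirror image of a rule is a rule, possibly read from right to left. -/
theorem IsotopyRule.mirror {X Y : List Slice} (h : IsotopyRule X Y) :
    IsotopyRule (mirrorStack X) (mirrorStack Y) ∨ IsotopyRule (mirrorStack Y) (mirrorStack X) := by
  cases h with
  | exchange g g' m =>
    have h := IsotopyRule.exchange g'.mirror g.mirror m.reverse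
    exact .inr (by simpa [-Gen.mirror] using h)
  | zigzag_left a => exact .inl (by simpa using IsotopyRule.zigzag_right a)
  | zigzag_right a => exact .inl (by simpa using IsotopyRule.zigzag_left a)
  | cap_slide k a b => exact .inr (by simpa using IsotopyRule.cap_slide k.flip a.flip b)
  | cup_slide k a b => exact .inr (by simpa using IsotopyRule.cup_slide k.flip a.flip b)
  | bar_cap a => exact .inr (by simpa using IsotopyRule.bar_cap a.flip)
  | bar_cup a => exact .inr (by simpa using IsotopyRule.bar_cup a.flip)

theorem VRule.mirror {X Y : List Slice} (h : VRule X Y) :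
    VRule (mirrorStack X) (mirrorStack Y) ∨ VRule (mirrorStack Y) (mirrorStack X) := by
  cases h with
  | v1 a => exact .inl (by simpa using VRule.v1 a.flip)
  | v2 a b => exact .inl (by simpa using VRule.v2 b a)
  | v3 a b c => exact .inr (by simpa using VRule.v3 c b a)
  | v4_ab k hk a b c => exact .inr (by simpa using VRule.v4_bc k hk c b a)
  | v4_ac k hk a b c => exact .inr (by simpa using VRule.v4_ac k hk c b a)
  | v4_bc k hk a b c => exact .inr (by simpa using VRule.v4_ab k hk c b a)

theorem RRule.mirror {X Y : List Slice} (h : RRule X Y) :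
    RRule (mirrorStack X) (mirrorStack Y) ∨ RRule (mirrorStack Y) (mirrorStack X) := by
  cases h with
  | r1 k hk a => exact .inl (by simpa using RRule.r1 k hk a.flip)
  | r2 k hk a b => exact .inl (by simpa using RRule.r2 k hk b a)
  | r3 kab kac kbc hab hac hbc h a b c =>
    have h' : kbc = kab → kac = kbc := fun e => (h e.symm).trans e.symm
    exact .inr (by simpa using RRule.r3 kbc kac kab hbc hac hab h' c b a)

end

theorem VEq.rule_mirror {u v : List Dir} {X Y : List Slice} (h : IsotopyRule X Y ∨ VRule X Y)
    (hX : Composable u X v) (hY : Composable u Y v) :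
    VEq u.reverse v.reverse (mirrorStack X) (mirrorStack Y) := by
  have h' : (IsotopyRule (mirrorStack X) (mirrorStack Y) ∨ VRule (mirrorStack X) (mirrorStack Y)) ∨
      (IsotopyRule (mirrorStack Y) (mirrorStack X) ∨ VRule (mirrorStack Y) (mirrorStack X)) := by
    rcases h with h | h
    · exact h.mirror.imp .inl .inl
    · exact h.mirror.imp .inr .inr
  rcases h' with h' | h'
  · have e := VEq.rule [] [] h' hX.mirror hY.mirror
    rw [wide_nil_nil, wide_nil_nil] at e
    simpa using e
  · have e := VEq.rule [] [] h' hY.mirror hX.mirror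
    rw [wide_nil_nil, wide_nil_nil] at e
    simpa using e.symm

/-- Two stacks of regions of a twisted link diagram, from `w` to `w'`, whose parts of the double
covering diagram are related by isotopies and V-moves. -/
structure Cov (w w' : List Dir) (L M : List Slice) : Prop where
  left : Composable w L w'
  right : Composable w M w'
  veq : VEq (w.reverse ++ w) (w'.reverse ++ w') (L.flatMap Slice.double) (M.flatMap Slice.double)

theorem Cov.refl {w w' : List Dir} {L : List Slice} (h : Composable w L w') : Cov w w' L L :=
  ⟨h, h, .refl (composable_double h)⟩

theorem Cov.symm {w w' : List Dir} {L M : List Slice} (h : Cov w w' L M) : Cov w w' M L :=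
  ⟨h.right, h.left, h.veq.symm⟩

theorem Cov.trans {w w' : List Dir} {L M N : List Slice} (h : Cov w w' L M) (h' : Cov w w' M N) :
    Cov w w' L N :=
  ⟨h.left, h'.right, h.veq.trans h'.veq⟩

theorem Cov.comp {w w' w'' : List Dir} {L L' M M' : List Slice} (h : Cov w w' L L')
    (h' : Cov w' w'' M M') : Cov w w'' (L ++ M) (L' ++ M') :=
  ⟨h.left.append h'.left, h.right.append h'.right, by
    rw [List.flatMap_append, List.flatMap_append]
    exact h.veq.comp h'.veq⟩

theorem Cov.context {w w' u v : List Dir} {A B : List Slice} (h : Cov u v A B) (hA : A ≠ [])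
    {P Q : List Slice} (hc : Composable w (P ++ A ++ Q) w') :
    Cov w w' (P ++ A ++ Q) (P ++ B ++ Q) := by
  obtain ⟨hP, hQ⟩ := Composable.split hA h.left hc
  exact ((Cov.refl hP).comp h).comp (.refl hQ)

/-- Isotopies and V-moves without bars are covered by two copies of themselves. -/
theorem Cov.rule {u v : List Dir} {X Y : List Slice} (h : IsotopyRule X Y ∨ VRule X Y)
    (hX : Composable u X v) (hY : Composable u Y v) (hb : NoBar X) (l r : List Dir) :
    Cov (l ++ u ++ r) (l ++ v ++ r) (wide l r X) (wide l r Y) := by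
  have e := VEq.rule l r h hX hY
  have hb' : NoBar (wide l r Y) := e.noBar_iff.1 (noBar_wide.2 hb)
  refine ⟨hX.wide l r, hY.wide l r, ?_⟩
  refine (double_of_noBar (noBar_wide.2 hb) (hX.wide l r)).trans
    (.trans ?_ (double_of_noBar hb' (hY.wide l r)).symm)
  have h1 := ((VEq.rule_mirror h hX hY).widen r.reverse l.reverse).widen [] (l ++ u ++ r)
  have h2 := e.widen (l ++ v ++ r).reverse []
  rw [← mirrorStack_wide, ← mirrorStack_wide] at h1
  simp only [List.nil_append, List.append_nil, List.append_assoc, List.reverse_append] at h1 h2 ⊢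
  exact h1.comp h2

/-! ### The replacement at the level of a bar -/

theorem wide_passRight (p q l : List Dir) (a : Dir) (m r : List Dir) :
    wide p q (passRight l a m r) = passRight (p ++ l) a m (r ++ q) := by
  induction m generalizing l with
  | nil => rfl
  | cons b m ih =>
    have := ih (l ++ [b])
    simp_all [passRight, wide, Slice.widen]

theorem wide_passLeft (p q l : List Dir) (a : Dir) (m r : List Dir) :
    wide p q (passLeft l a m r) = passLeft (p ++ l) a m (r ++ q) := by
  induction m generalizing l with
  | nil => rfl
  | cons b m ih =>
    have := ih (l ++ [b])
    simp_all [passLeft, wide, Slice.widen]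

theorem passRight_append (l : List Dir) (a : Dir) (x y r : List Dir) :
    passRight l a (x ++ y) r = passRight l a x (y ++ r) ++ passRight (l ++ x) a y r := by
  induction x generalizing l with
  | nil => simp [passRight]
  | cons b x ih => simp [passRight, ih]

theorem passLeft_append (l : List Dir) (a : Dir) (x y r : List Dir) :
    passLeft l a (x ++ y) r = passLeft (l ++ x) a y r ++ passLeft l a x (y ++ r) := by
  induction x generalizing l with
  | nil => simp [passLeft]
  | cons b x ih => simp [passLeft, ih]

theorem wide_barBlock (p q l : List Dir) (a : Dir) (r : List Dir) (h : p = q.reverse) :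
    wide p q (barBlock l a r) = barBlock l a (r ++ q) := by
  subst h
  have h1 := fun l a m r => wide_passRight q.reverse q l a m r
  have h2 := fun l a m r => wide_passLeft q.reverse q l a m r
  simp only [barBlock, wide, List.map_append] at *
  simp [h1, h2, Slice.widen]

/-- A bar with a further strand `b` on its left: up to isotopy, the replacement arises from the one
in which `b` has been moved to the other side of the bar, in `D` and in `s(D)`. -/
theorem barBlock_snoc (l : List Dir) (b a : Dir) (r : List Dir) :
    VEq (r.reverse ++ a :: b :: l.reverse ++ l ++ b :: a :: r)
      (r.reverse ++ a :: b :: l.reverse ++ l ++ b :: a :: r) (barBlock (l ++ [b]) a r)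
      (Slice.double ⟨l, .cross .virtual b a, r⟩ ++ barBlock l a (b :: r) ++
        Slice.double ⟨l, .cross .virtual a b, r⟩) := by
  -- The crossing of `b` with the bar's strand in `D` moves below the part of the braid in `s(D)`.
  have e1 := interchange (composable_passRight (r.reverse ++ [b]) a l.reverse l)
    (u' := [b, a] ++ r) (v' := [a, b] ++ r) (Y := [⟨[], .cross .virtual b a, r⟩])
    (by simp [Composable, Slice.dom, Slice.cod, Gen.dom, Gen.cod])
  -- The second crossing with the mirror image of `b` moves above the part of the braid in `D`.
  have e2 := interchange (u := r.reverse ++ [b, a] ++ l.reverse)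
    (v := r.reverse ++ [a, b] ++ l.reverse)
    (X := [⟨r.reverse, .cross .virtual b a, l.reverse⟩])
    (by simp [Composable, Slice.dom, Slice.cod, Gen.dom, Gen.cod])
    (composable_passRight [] a l (b :: r))
  rw [wide_passRight, wide_passRight] at e1 e2
  have c1 : Composable (r.reverse ++ a :: b :: l.reverse ++ l ++ b :: a :: r)
      [⟨r.reverse, .cross .virtual a b, l.reverse ++ l ++ b :: a :: r⟩]
      (r.reverse ++ b :: a :: l.reverse ++ l ++ b :: a :: r) := by
    simp [Composable, Slice.dom, Slice.cod, Gen.dom, Gen.cod]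
  have c2 := composable_passLeft ((r.reverse ++ [b]) ++ l.reverse ++ [a]) a l (b :: r)
  have c3 : Composable (r.reverse ++ b :: l.reverse ++ a :: a :: l ++ b :: r)
      [⟨r.reverse ++ b :: l.reverse, .cross .virtual a a, l ++ b :: r⟩]
      (r.reverse ++ b :: l.reverse ++ a :: a :: l ++ b :: r) := by
    simp [Composable, Slice.dom, Slice.cod, Gen.dom, Gen.cod]
  have c4 := composable_passLeft (r.reverse ++ [b]) a l.reverse (a :: l ++ b :: r)
  have c5 : Composable (r.reverse ++ a :: b :: l.reverse ++ l ++ a :: b :: r)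
      [⟨r.reverse ++ a :: b :: l.reverse ++ l, .cross .virtual a b, r⟩]
      (r.reverse ++ a :: b :: l.reverse ++ l ++ b :: a :: r) := by
    simp [Composable, Slice.dom, Slice.cod, Gen.dom, Gen.cod]
  simp only [List.append_assoc, List.cons_append, List.nil_append, List.append_nil]
    at e1 e2 c1 c2 c3 c4 c5 ⊢
  have h := (((((VEq.refl c1).comp e1).comp (.refl c2)).comp (.refl c3)).comp (.refl c4)).comp
    (e2.comp (.refl c5))
  simpa [barBlock, passRight, passLeft, passRight_append, passLeft_append, Slice.double, wide,
    Slice.widen, Gen.mirror, Gen.reflect, Gen.switch, Gen.dom, Gen.cod, Kind.flip] using h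

/-- The two sides of a local move may be exchanged at any place of a twisted link diagram, the
double covering diagram changing by isotopies and V-moves. -/
def CovRule (X Y : List Slice) : Prop :=
  ∀ u v l r, Composable u X v → Composable u Y v →
    Cov (l ++ u ++ r) (l ++ v ++ r) (wide l r X) (wide l r Y)

theorem CovRule.of_rule {X Y : List Slice} (h : IsotopyRule X Y ∨ VRule X Y) (hb : NoBar X) :
    CovRule X Y := fun _ _ l r hX hY => Cov.rule h hX hY hb l r

theorem VRule.covRule {X Y : List Slice} (h : VRule X Y) : CovRule X Y := by
  refine .of_rule (.inr h) ?_
  cases h <;> simp [NoBar, triangleLeft]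

/-- Two virtual crossings of the same strands cancel. -/
theorem Cov.cancel (l : List Dir) (a b : Dir) (r : List Dir) :
    Cov (l ++ a :: b :: r) (l ++ a :: b :: r)
      [⟨l, .cross .virtual a b, r⟩, ⟨l, .cross .virtual b a, r⟩] [] := by
  have h := (VRule.v2 a b).covRule [a, b] [a, b] l r
    (by simp [Composable, Slice.dom, Slice.cod, Gen.dom, Gen.cod]) rfl
  simpa [wide, Slice.widen] using h

/-- A bar is moved to the other side of the strand `b` next to it. -/
theorem Cov.bar_snoc (l : List Dir) (b a : Dir) (r : List Dir) :
    Cov (l ++ b :: a :: r) (l ++ b :: a :: r) [⟨l ++ [b], .bar a, r⟩]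
      ([⟨l, .cross .virtual b a, r⟩] ++ [⟨l, .bar a, b :: r⟩] ++
        [⟨l, .cross .virtual a b, r⟩]) := by
  refine ⟨?_, ?_, ?_⟩
  · simp [Composable, Slice.dom, Slice.cod, Gen.dom, Gen.cod]
  · simp [Composable, Slice.dom, Slice.cod, Gen.dom, Gen.cod]
  · have h := barBlock_snoc l b a r
    simpa only [List.flatMap_append, List.flatMap_cons, List.flatMap_nil, List.append_nil,
      Slice.double.eq_1, List.reverse_append, List.reverse_cons, List.append_assoc,
      List.cons_append, List.nil_append] using h

theorem CovRule.t1_left (a b : Dir) : CovRule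
    [⟨[], .bar a, [b]⟩, ⟨[], .cross .virtual a b, []⟩]
    [⟨[], .cross .virtual a b, []⟩, ⟨[b], .bar a, []⟩] := by
  intro u v l r hX hY
  obtain rfl := hX.1
  obtain rfl := hX.2.2
  have c1 : Composable (l ++ a :: b :: r) [⟨l, .cross .virtual a b, r⟩] (l ++ b :: a :: r) := by
    simp [Composable, Slice.dom, Slice.cod, Gen.dom, Gen.cod]
  have c2 : Composable (l ++ a :: b :: r)
      ([⟨l, .bar a, b :: r⟩] ++ [⟨l, .cross .virtual a b, r⟩]) (l ++ b :: a :: r) := by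
    simp [Composable, Slice.dom, Slice.cod, Gen.dom, Gen.cod]
  have h1 := (Cov.refl c1).comp (Cov.bar_snoc l b a r)
  have h2 := (Cov.cancel l a b r).comp (.refl c2)
  simpa [wide, Slice.widen, Slice.dom, Slice.cod, Gen.dom, Gen.cod] using (h1.trans h2).symm

theorem CovRule.t1_right (a b : Dir) : CovRule
    [⟨[a], .bar b, []⟩, ⟨[], .cross .virtual a b, []⟩]
    [⟨[], .cross .virtual a b, []⟩, ⟨[], .bar b, [a]⟩] := by
  intro u v l r hX hY
  obtain rfl := hX.1
  obtain rfl := hX.2.2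
  have c1 : Composable (l ++ a :: b :: r) [⟨l, .cross .virtual a b, r⟩] (l ++ b :: a :: r) := by
    simp [Composable, Slice.dom, Slice.cod, Gen.dom, Gen.cod]
  have c2 : Composable (l ++ a :: b :: r)
      ([⟨l, .cross .virtual a b, r⟩] ++ [⟨l, .bar b, a :: r⟩]) (l ++ b :: a :: r) := by
    simp [Composable, Slice.dom, Slice.cod, Gen.dom, Gen.cod]
  have h1 := (Cov.bar_snoc l a b r).comp (Cov.refl c1)
  have h2 := (Cov.refl c2).comp (Cov.cancel l b a r)
  simpa [wide, Slice.widen, Slice.dom, Slice.cod, Gen.dom, Gen.cod] using h1.trans h2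

theorem Cov.bar_bar (l : List Dir) (a : Dir) (r : List Dir) :
    Cov (l ++ a :: r) (l ++ a :: r) [⟨l, .bar a, r⟩, ⟨l, .bar a, r⟩] [] := by
  induction l using List.reverseRecOn generalizing r with
  | nil =>
    refine ⟨by simp [Composable, Slice.dom, Slice.cod, Gen.dom, Gen.cod], rfl, ?_⟩
    have h := VEq.rule r.reverse r (.inr (VRule.v2 a a)) (u := [a, a]) (v := [a, a])
      (by simp [Composable, Slice.dom, Slice.cod, Gen.dom, Gen.cod]) rfl
    simpa [Slice.double, barBlock, passRight, passLeft, wide, Slice.widen] using h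
  | append_singleton l b ih =>
    have c1 : Composable (l ++ b :: a :: r)
        ([⟨l, .cross .virtual b a, r⟩] ++ [⟨l, .bar a, b :: r⟩]) (l ++ a :: b :: r) := by
      simp [Composable, Slice.dom, Slice.cod, Gen.dom, Gen.cod]
    have c2 : Composable (l ++ a :: b :: r)
        ([⟨l, .bar a, b :: r⟩] ++ [⟨l, .cross .virtual a b, r⟩]) (l ++ b :: a :: r) := by
      simp [Composable, Slice.dom, Slice.cod, Gen.dom, Gen.cod]
    have c3 : Composable (l ++ b :: a :: r) [⟨l, .cross .virtual b a, r⟩] (l ++ a :: b :: r) := by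
      simp [Composable, Slice.dom, Slice.cod, Gen.dom, Gen.cod]
    have c4 : Composable (l ++ a :: b :: r) [⟨l, .cross .virtual a b, r⟩] (l ++ b :: a :: r) := by
      simp [Composable, Slice.dom, Slice.cod, Gen.dom, Gen.cod]
    have h1 := (Cov.bar_snoc l b a r).comp (Cov.bar_snoc l b a r)
    have h2 := ((Cov.refl c1).comp (Cov.cancel l a b r)).comp (.refl c2)
    have h3 := ((Cov.refl c3).comp (ih (b :: r))).comp (.refl c4)
    have h4 := Cov.cancel l b a r
    simp only [List.append_assoc, List.cons_append, List.nil_append] at h1 h2 h3 h4 ⊢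
    exact h1.trans (h2.trans (h3.trans h4))

theorem CovRule.t2 (a : Dir) : CovRule [⟨[], .bar a, []⟩, ⟨[], .bar a, []⟩] [] := by
  intro u v l r hX hY
  obtain rfl := hX.1
  obtain rfl := hX.2.2
  simpa [wide, Slice.widen, Slice.dom, Slice.cod, Gen.dom, Gen.cod] using Cov.bar_bar l a r

/-- A bar, with strands `x` moved away from its left side and back. -/
theorem Cov.bar_conj (l x : List Dir) (a : Dir) (r : List Dir) :
    Cov (l ++ x ++ a :: r) (l ++ x ++ a :: r) [⟨l ++ x, .bar a, r⟩]
      (passLeft l a x r ++ [⟨l, .bar a, x ++ r⟩] ++ passRight l a x r) := by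
  induction x using List.reverseRecOn generalizing r with
  | nil =>
    simpa [passLeft, passRight] using
      Cov.refl (L := [⟨l, .bar a, r⟩]) (w := l ++ a :: r) (w' := l ++ a :: r)
        (by simp [Composable, Slice.dom, Slice.cod, Gen.dom, Gen.cod])
  | append_singleton x b ih =>
    have c1 : Composable (l ++ x ++ b :: a :: r) [⟨l ++ x, .cross .virtual b a, r⟩]
        (l ++ x ++ a :: b :: r) := by
      simp [Composable, Slice.dom, Slice.cod, Gen.dom, Gen.cod]
    have c2 : Composable (l ++ x ++ a :: b :: r) [⟨l ++ x, .cross .virtual a b, r⟩]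
        (l ++ x ++ b :: a :: r) := by
      simp [Composable, Slice.dom, Slice.cod, Gen.dom, Gen.cod]
    have h1 := Cov.bar_snoc (l ++ x) b a r
    have h2 := ((Cov.refl c1).comp (ih (b :: r))).comp (.refl c2)
    rw [passLeft_append, passRight_append]
    simp only [List.append_assoc, List.cons_append, List.nil_append, passLeft, passRight] at h1 h2 ⊢
    exact h1.trans h2

/-- A strand that passes others through virtual crossings and returns may be straightened. -/
theorem Cov.passLeft_passRight (l x : List Dir) (a : Dir) (r : List Dir) :
    Cov (l ++ x ++ a :: r) (l ++ x ++ a :: r) (passLeft l a x r ++ passRight l a x r) [] := by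
  induction x using List.reverseRecOn generalizing r with
  | nil => exact .refl (by simp [Composable, passLeft, passRight])
  | append_singleton x b ih =>
    have c1 : Composable (l ++ x ++ b :: a :: r) [⟨l ++ x, .cross .virtual b a, r⟩]
        (l ++ x ++ a :: b :: r) := by
      simp [Composable, Slice.dom, Slice.cod, Gen.dom, Gen.cod]
    have c2 : Composable (l ++ x ++ a :: b :: r) [⟨l ++ x, .cross .virtual a b, r⟩]
        (l ++ x ++ b :: a :: r) := by
      simp [Composable, Slice.dom, Slice.cod, Gen.dom, Gen.cod]
    have h1 := Cov.cancel (l ++ x) b a r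
    have h2 := ((Cov.refl c1).comp (ih (b :: r))).comp (.refl c2)
    rw [passLeft_append, passRight_append]
    simp only [List.append_assoc, List.cons_append, List.nil_append, passLeft, passRight] at h1 h2 ⊢
    exact h2.trans h1

theorem Cov.passRight_passLeft (l x : List Dir) (a : Dir) (r : List Dir) :
    Cov (l ++ a :: x ++ r) (l ++ a :: x ++ r) (passRight l a x r ++ passLeft l a x r) [] := by
  induction x generalizing l with
  | nil => exact .refl (by simp [Composable, passLeft, passRight])
  | cons b x ih =>
    have c1 : Composable (l ++ a :: b :: x ++ r) [⟨l, .cross .virtual a b, x ++ r⟩]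
        (l ++ b :: a :: x ++ r) := by
      simp [Composable, Slice.dom, Slice.cod, Gen.dom, Gen.cod]
    have c2 : Composable (l ++ b :: a :: x ++ r) [⟨l, .cross .virtual b a, x ++ r⟩]
        (l ++ a :: b :: x ++ r) := by
      simp [Composable, Slice.dom, Slice.cod, Gen.dom, Gen.cod]
    have h1 := Cov.cancel l a b (x ++ r)
    have ih := ih (l ++ [b])
    simp only [List.append_assoc, List.cons_append, List.nil_append, passLeft, passRight]
      at h1 ih c1 c2 ⊢
    have h2 := ((Cov.refl c1).comp ih).comp (.refl c2)
    simp only [List.append_assoc, List.cons_append, List.nil_append] at h2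
    exact h2.trans h1

/-! ### Naturality of virtual crossings and exchange of heights -/

/-- The elementary pieces `g` (on the left) and `g'` (on the right) may exchange their heights. -/
def Exch (g g' : Gen) : Prop := ∀ l m r : List Dir,
  Cov (l ++ g.dom ++ m ++ g'.dom ++ r) (l ++ g.cod ++ m ++ g'.cod ++ r)
    ([⟨l, g, m ++ g'.dom ++ r⟩] ++ [⟨l ++ g.cod ++ m, g', r⟩])
    ([⟨l ++ g.dom ++ m, g', r⟩] ++ [⟨l, g, m ++ g'.cod ++ r⟩])

theorem Exch.of_noBar {g g' : Gen} (hg : ∀ a, g ≠ .bar a) (hg' : ∀ a, g' ≠ .bar a) :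
    Exch g g' := by
  intro l m r
  have h := CovRule.of_rule (.inl (IsotopyRule.exchange g g' m)) (by simp [NoBar, hg, hg'])
    (g.dom ++ m ++ g'.dom) (g.cod ++ m ++ g'.cod) l r (by simp [Composable, Slice.dom, Slice.cod])
    (by simp [Composable, Slice.dom, Slice.cod])
  simpa [wide, Slice.widen] using h

/-- A strand `b` passes the elementary piece `g` from left to right. -/
def Through (g : Gen) : Prop := ∀ (l : List Dir) (b : Dir) (r : List Dir),
  Cov (l ++ b :: g.dom ++ r) (l ++ g.cod ++ b :: r)
    ([⟨l ++ [b], g, r⟩] ++ passRight l b g.cod r) (passRight l b g.dom r ++ [⟨l, g, b :: r⟩])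

theorem Slice.composable (l : List Dir) (g : Gen) (r : List Dir) :
    Composable (l ++ g.dom ++ r) [⟨l, g, r⟩] (l ++ g.cod ++ r) := ⟨rfl, rfl⟩

/-- Two strands that cross in a double point of any kind are passed by a third strand through
virtual crossings: V3 or V4. -/
theorem VRule.triangle_ab (k : Kind) (a b c : Dir) :
    VRule (triangleLeft k .virtual .virtual a b c) (triangleRight k .virtual .virtual a b c) := by
  cases k with
  | virtual => exact .v3 a b c
  | _ => exact .v4_ab _ (by simp [Kind.IsReal]) a b c

theorem VRule.triangle_bc (k : Kind) (a b c : Dir) :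
    VRule (triangleLeft .virtual .virtual k a b c) (triangleRight .virtual .virtual k a b c) := by
  cases k with
  | virtual => exact .v3 a b c
  | _ => exact .v4_bc _ (by simp [Kind.IsReal]) a b c

theorem Through.cup (a : Dir) : Through (.cup a) := by
  intro l b r
  have h1 := CovRule.of_rule (.inl (IsotopyRule.cup_slide .virtual a b)) (by simp [NoBar])
    [b] [a, b, a.flip] l r (by simp [Composable, Slice.dom, Slice.cod, Gen.dom, Gen.cod])
    (by simp [Composable, Slice.dom, Slice.cod, Gen.dom, Gen.cod])
  have h2 := Cov.cancel (l ++ [a]) a.flip b r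
  have c1 := Slice.composable (l ++ [a]) (.cross .virtual b a.flip) r
  have c2 := Slice.composable l (.cup a) (b :: r)
  simp only [wide, Slice.widen, List.map_cons, List.map_nil, List.append_assoc, List.cons_append,
    List.nil_append, Gen.dom, Gen.cod, Kind.flip, List.append_nil] at h1 h2 c1 c2
  have h := (h1.comp (.refl c1)).trans ((Cov.refl c2).comp h2)
  simpa [Gen.dom, Gen.cod, passRight] using h

theorem Through.cap (a : Dir) : Through (.cap a) := by
  intro l b r
  have h1 := CovRule.of_rule (.inl (IsotopyRule.cap_slide .virtual a b)) (by simp [NoBar])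
    [a, b, a.flip] [b] l r (by simp [Composable, Slice.dom, Slice.cod, Gen.dom, Gen.cod])
    (by simp [Composable, Slice.dom, Slice.cod, Gen.dom, Gen.cod])
  have h2 := Cov.cancel l b a (a.flip :: r)
  have c1 := Slice.composable l (.cross .virtual b a) (a.flip :: r)
  have c2 := Slice.composable (l ++ [b]) (.cap a) r
  simp only [wide, Slice.widen, List.map_cons, List.map_nil, List.append_assoc, List.cons_append,
    List.nil_append, Gen.dom, Gen.cod, Kind.flip, List.append_nil] at h1 h2 c1 c2
  have h := ((Cov.refl c1).comp h1).symm.trans (h2.comp (.refl c2))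
  simpa [Gen.dom, Gen.cod, passRight] using h.symm

theorem Through.cross (k : Kind) (c d : Dir) : Through (.cross k c d) := by
  intro l b r
  have h1 := (VRule.triangle_bc k b c d).covRule [b, c, d] [d, c, b] l r
    (by simp [Composable, Slice.dom, Slice.cod, Gen.dom, Gen.cod, triangleLeft])
    (by simp [Composable, Slice.dom, Slice.cod, Gen.dom, Gen.cod, triangleRight])
  simpa [Gen.dom, Gen.cod, passRight, wide, Slice.widen, triangleLeft, triangleRight] using h1.symm

theorem Through.bar (a : Dir) : Through (.bar a) := by
  intro l b r
  have h1 := CovRule.t1_right b a [b, a] [a, b] l r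
    (by simp [Composable, Slice.dom, Slice.cod, Gen.dom, Gen.cod])
    (by simp [Composable, Slice.dom, Slice.cod, Gen.dom, Gen.cod])
  simpa [Gen.dom, Gen.cod, passRight, wide, Slice.widen] using h1

theorem Through.all (g : Gen) : Through g := by
  cases g with
  | cup a => exact .cup a
  | cap a => exact .cap a
  | cross k a b => exact .cross k a b
  | bar a => exact .bar a

/-- The piece `g` exchanges its height with the virtual crossings on either side. -/
def ExchCross (g : Gen) : Prop :=
  (∀ a b, Exch (.cross .virtual a b) g) ∧ ∀ a b, Exch g (.cross .virtual a b)

theorem ExchCross.passRight_left {g : Gen} (hg : ExchCross g) (l : List Dir) (b : Dir)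
    (p r : List Dir) :
    Cov (l ++ b :: p ++ g.dom ++ r) (l ++ p ++ b :: g.cod ++ r)
      ([⟨l ++ b :: p, g, r⟩] ++ passRight l b p (g.cod ++ r))
      (passRight l b p (g.dom ++ r) ++ [⟨l ++ p ++ [b], g, r⟩]) := by
  induction p generalizing l with
  | nil =>
    simpa [passRight] using Cov.refl (Slice.composable (l ++ [b]) g r)
  | cons c p ih =>
    have h1 := hg.1 b c l p r
    have h2 := ih (l ++ [c])
    have c1 := composable_passRight (l ++ [c]) b p (g.cod ++ r)
    have c2 := Slice.composable l (.cross .virtual b c) (p ++ g.dom ++ r)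
    simp only [List.append_assoc, List.cons_append, List.nil_append, Gen.dom, Gen.cod]
      at h1 h2 c1 c2 ⊢
    have h := (h1.symm.comp (.refl c1)).trans ((Cov.refl c2).comp h2)
    simpa [passRight] using h

theorem ExchCross.passRight_right {g : Gen} (hg : ExchCross g) (l m : List Dir) (b : Dir)
    (q r : List Dir) :
    Cov (l ++ g.dom ++ m ++ b :: q ++ r) (l ++ g.cod ++ m ++ q ++ b :: r)
      ([⟨l, g, m ++ b :: q ++ r⟩] ++ passRight (l ++ g.cod ++ m) b q r)
      (passRight (l ++ g.dom ++ m) b q r ++ [⟨l, g, m ++ q ++ b :: r⟩]) := by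
  induction q generalizing m with
  | nil =>
    simpa [passRight] using Cov.refl (Slice.composable l g (m ++ b :: r))
  | cons c q ih =>
    have h1 := hg.2 b c l m (q ++ r)
    have h2 := ih (m ++ [c])
    have c1 := composable_passRight (l ++ g.cod ++ m ++ [c]) b q r
    have c2 := Slice.composable (l ++ g.dom ++ m) (.cross .virtual b c) (q ++ r)
    simp only [List.append_assoc, List.cons_append, List.nil_append, Gen.dom, Gen.cod]
      at h1 h2 c1 c2 ⊢
    have h := (h1.comp (.refl c1)).trans ((Cov.refl c2).comp h2)
    simpa [passRight] using h

/-- A strand passes a region from left to right. -/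
theorem ExchCross.natural {s : Slice} (hs : ExchCross s.gen) (l : List Dir) (b : Dir)
    (r : List Dir) :
    Cov (l ++ b :: s.dom ++ r) (l ++ s.cod ++ b :: r)
      ([s.widen (l ++ [b]) r] ++ passRight l b s.cod r)
      (passRight l b s.dom r ++ [s.widen l (b :: r)]) := by
  rcases s with ⟨p, g, q⟩
  have h1 := hs.passRight_left l b p (q ++ r)
  have h2 := Through.all g (l ++ p) b (q ++ r)
  have h3 := hs.passRight_right (l ++ p) [] b q r
  have c1 := composable_passRight (l ++ p) b g.cod (q ++ r)
  have c2 := composable_passRight (l ++ p ++ g.cod) b q r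
  have c3 := composable_passRight l b p (g.dom ++ q ++ r)
  have c4 := composable_passRight (l ++ p) b g.dom (q ++ r)
  simp only [List.append_assoc, List.cons_append, List.nil_append] at h1 h2 h3 c1 c2 c3 c4
  have e1 := (h1.comp (.refl c1)).comp (.refl c2)
  have e2 := ((Cov.refl c3).comp h2).comp (.refl c2)
  have e3 := ((Cov.refl c3).comp (.refl c4)).comp h3
  simp only [List.append_assoc, List.cons_append, List.nil_append, List.append_nil] at e1 e2 e3
  have h := e1.trans (e2.trans e3)
  simpa [passRight_append, Slice.dom, Slice.cod, Slice.widen] using h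

theorem natural_stack {u v : List Dir} {X : List Slice} (hX : Composable u X v)
    (hx : ∀ s ∈ X, ExchCross s.gen) (l : List Dir) (b : Dir) (r : List Dir) :
    Cov (l ++ b :: u ++ r) (l ++ v ++ b :: r) (wide (l ++ [b]) r X ++ passRight l b v r)
      (passRight l b u r ++ wide l (b :: r) X) := by
  induction X generalizing u with
  | nil =>
    obtain rfl : u = v := hX
    simpa [wide] using Cov.refl (composable_passRight l b u r)
  | cons s X ih =>
    obtain ⟨rfl, hX⟩ := hX
    have h1 := (hx s (by simp)).natural l b r
    have h2 := ih hX fun t ht => hx t (by simp [ht])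
    have c1 := Slice.composable (l ++ [b] ++ s.left) s.gen (s.right ++ r)
    have c2 := hX.wide l (b :: r)
    simp only [List.append_assoc, List.cons_append, List.nil_append, Slice.dom, Slice.cod]
      at h1 h2 c1 c2 ⊢
    have e1 := (Cov.refl c1).comp h2
    have e2 := h1.comp (.refl c2)
    simp only [List.append_assoc, List.cons_append, List.nil_append, Slice.widen] at e1 e2
    simpa [wide, Slice.widen] using e1.trans e2

/-- A strand passes a stack of regions from right to left. -/
theorem natural_stack_left {u v : List Dir} {X : List Slice} (hX : Composable u X v)
    (hx : ∀ s ∈ X, ExchCross s.gen) (l : List Dir) (b : Dir) (r : List Dir) :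
    Cov (l ++ u ++ b :: r) (l ++ b :: v ++ r) (wide l (b :: r) X ++ passLeft l b v r)
      (passLeft l b u r ++ wide (l ++ [b]) r X) := by
  have h1 := natural_stack hX hx l b r
  have c1 := composable_passLeft l b u r
  have c2 := composable_passLeft l b v r
  have c3 := hX.wide l (b :: r)
  have c4 := hX.wide (l ++ [b]) r
  have e1 := Cov.passLeft_passRight l u b r
  have e2 := Cov.passRight_passLeft l v b r
  simp only [List.append_assoc, List.cons_append, List.nil_append] at h1 c1 c2 c3 c4 e1 e2 ⊢
  have h2 := (((Cov.refl c1).comp h1).comp (.refl c2))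
  have h3 := (e1.comp (.refl c3)).comp (.refl c2)
  have h4 := (Cov.refl c1).comp ((Cov.refl c4).comp e2)
  simp only [List.append_assoc, List.nil_append, List.append_nil] at h2 h3 h4
  exact h3.symm.trans (h2.symm.trans h4)

/-- A local move needs to be covered only at the left end of the diagram: the strands on its left
may be moved away. -/
theorem CovRule.of_left {X Y : List Slice} (hX : ∀ s ∈ X, ExchCross s.gen)
    (hY : ∀ s ∈ Y, ExchCross s.gen)
    (h : ∀ u v r, Composable u X v → Composable u Y v →
      Cov (u ++ r) (v ++ r) (wide [] r X) (wide [] r Y)) : CovRule X Y := by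
  intro u v l r cX cY
  induction l using List.reverseRecOn generalizing r with
  | nil => exact h u v r cX cY
  | append_singleton l b ih =>
    have aux : ∀ {Z : List Slice}, Composable u Z v → (∀ s ∈ Z, ExchCross s.gen) →
        Cov (l ++ b :: u ++ r) (l ++ b :: v ++ r) (wide (l ++ [b]) r Z)
          (passRight l b u r ++ wide l (b :: r) Z ++ passLeft l b v r) := by
      intro Z cZ hZ
      have h1 := natural_stack cZ hZ l b r
      have c2 := composable_passLeft l b v r
      have c4 := cZ.wide (l ++ [b]) r
      have e2 := Cov.passRight_passLeft l v b r
      simp only [List.append_assoc, List.cons_append, List.nil_append] at h1 c2 c4 e2 ⊢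
      have h2 := h1.comp (.refl c2)
      have h3 := (Cov.refl c4).comp e2
      simp only [List.append_assoc, List.append_nil] at h2 h3
      exact h3.symm.trans h2
    have c1 := composable_passRight l b u r
    have c2 := composable_passLeft l b v r
    have h1 := aux cX hX
    have h2 := aux cY hY
    have ih := ih (b :: r)
    simp only [List.append_assoc, List.cons_append, List.nil_append] at h1 h2 ih c1 c2 ⊢
    have h3 := (Cov.refl c1).comp (ih.comp (.refl c2))
    exact h1.trans (h3.trans h2.symm)

/-- A bar and a piece on its right exchange their heights, since the replacement at the level of
the bar takes place between that piece and its mirror image. -/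
theorem Exch.bar_left (a : Dir) {g : Gen} (hg : ∀ a, g ≠ .bar a) : Exch (.bar a) g := by
  intro l m r
  refine ⟨by simp [Composable, Slice.dom, Slice.cod],
    by simp [Composable, Slice.dom, Slice.cod], ?_⟩
  have hd : ∀ p q, Slice.double ⟨p, g, q⟩ = [⟨q.reverse, g.mirror, p.reverse ++ p ++ g.dom ++ q⟩,
      ⟨q.reverse ++ g.cod.reverse ++ p.reverse ++ p, g, q⟩] := by
    intro p q
    rw [Slice.double_of_noBar hg]
    simp [Slice.mirror, Slice.widen, Slice.dom, Slice.cod]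
  -- `B` is the part of the braid that does not involve the strands on the right of the bar.
  obtain ⟨B, hB, hb⟩ : ∃ B, Composable (a :: l.reverse ++ l ++ [a]) B (a :: l.reverse ++ l ++ [a]) ∧
      ∀ q, barBlock l a q = wide q.reverse q B :=
    ⟨_, composable_barBlock l a [], fun q => (wide_barBlock q.reverse q l a [] rfl).symm⟩
  have hB := hB.wide m.reverse m
  have h1 := interchange (Slice.composable r.reverse g.mirror []) hB
  have h2 := interchange hB (Slice.composable [] g r)
  rw [wide_wide, wide_wide] at h1 h2
  have h3 := h1.widen [] (g.dom ++ r)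
  have h4 := h2.widen (r.reverse ++ g.mirror.cod) []
  have c1 := Slice.composable r.reverse g.mirror
    (m.reverse ++ a :: l.reverse ++ l ++ a :: m ++ g.dom ++ r)
  have c2 := Slice.composable
    (r.reverse ++ g.mirror.cod ++ m.reverse ++ a :: l.reverse ++ l ++ a :: m) g r
  simp only [wide, List.map_append, List.map_map, List.map_cons,
    List.map_nil, Function.comp_def, Slice.widen, Gen.dom_mirror, Gen.cod_mirror, List.append_assoc,
    List.cons_append, List.nil_append, List.append_nil] at h3 h4 c1 c2
  have e1 := h3.symm.comp (.refl c2)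
  have e2 := (VEq.refl c1).comp h4
  simp only [List.append_assoc, List.cons_append, List.nil_append] at e1 e2
  have hw : ∀ p q, Slice.widen p q = fun x => ⟨p ++ x.left, x.gen, x.right ++ q⟩ := fun _ _ => rfl
  have d1 : (Gen.bar a).dom = [a] := rfl
  have d2 : (Gen.bar a).cod = [a] := rfl
  have d3 : ∀ p q, Slice.double ⟨p, .bar a, q⟩ = barBlock p a q := fun _ _ => rfl
  simpa [hd, hb, wide, hw, d1, d2, d3] using e1.trans e2

theorem ExchCross.of_noBar {g : Gen} (hg : ∀ a, g ≠ .bar a) : ExchCross g :=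
  ⟨fun _ _ => .of_noBar (by simp) hg, fun _ _ => .of_noBar hg (by simp)⟩

/-- A piece and a bar on its right exchange their heights: the strand with the bar is moved past the
piece, where the bar is on its left. -/
theorem Exch.bar_right {g : Gen} (hg : ∀ a, g ≠ .bar a) (a : Dir) : Exch g (.bar a) := by
  intro l m r
  have n1 := natural_stack_left (X := [⟨[], g, m⟩]) (u := g.dom ++ m) (v := g.cod ++ m)
    (by simp [Composable, Slice.dom, Slice.cod])
    (by simpa using ExchCross.of_noBar hg) l a r
  have n2 := natural_stack (X := [⟨[], g, m⟩]) (u := g.dom ++ m) (v := g.cod ++ m)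
    (by simp [Composable, Slice.dom, Slice.cod])
    (by simpa using ExchCross.of_noBar hg) l a r
  have b1 := Cov.bar_conj l (g.dom ++ m) a r
  have b2 := Cov.bar_conj l (g.cod ++ m) a r
  have x := Exch.bar_left a hg l [] (m ++ r)
  have c1 := Slice.composable l g (m ++ a :: r)
  have c2 := Slice.composable l (.bar a) (g.cod ++ m ++ r)
  have c3 := composable_passRight l a (g.cod ++ m) r
  have c4 := composable_passLeft l a (g.dom ++ m) r
  have c5 := Slice.composable l (.bar a) (g.dom ++ m ++ r)
  simp only [wide, Slice.widen, List.map_cons, List.map_nil, List.append_assoc, List.cons_append,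
    List.nil_append, Gen.dom, Gen.cod, List.append_nil] at n1 n2 b1 b2 x c1 c2 c3 c4 c5 ⊢
  have e1 := (Cov.refl c1).comp b2
  have e2 := (n1.comp (.refl c2)).comp (.refl c3)
  have e3 := ((Cov.refl c4).comp x.symm).comp (.refl c3)
  have e4 := ((Cov.refl c4).comp (.refl c5)).comp n2
  have e5 := b1.comp (.refl c1)
  simp only [List.append_assoc, List.cons_append, List.nil_append] at e1 e2 e3 e4 e5
  exact e1.trans (e2.trans (e3.trans (e4.trans e5.symm)))

theorem ExchCross.all (g : Gen) : ExchCross g := by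
  cases g with
  | bar c => exact ⟨fun _ _ => .bar_right (by simp) c, fun _ _ => .bar_left c (by simp)⟩
  | _ => exact .of_noBar (by simp)

/-! ### T-moves and bars at maximal points -/

section

attribute [local simp] Composable Slice.dom Slice.cod Gen.dom Gen.cod Dir.flip_flip triangleLeft
  triangleRight Slice.widen wide

/-- A local move inside a larger stack. -/
theorem VEq.move {X Y : List Slice} (h : IsotopyRule X Y ∨ VRule X Y) (P Q : List Slice)
    (l r : List Dir) {w w' : List Dir} (hc : Composable w (P ++ wide l r X ++ Q) w') :
    VEq w w' (P ++ wide l r X ++ Q) (P ++ wide l r Y ++ Q) := by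
  obtain ⟨hX, u, v, cX, cY⟩ : WellTyped X Y := h.elim (·.wellTyped) (·.wellTyped)
  exact (VEq.rule l r h cX cY).context (by simpa using hX) hc

/-- The virtual braid in which the strands `p`, `q` cross the strands `t`, `u`. -/
def blockSwap (p q t u : Dir) : List Slice :=
  [⟨[p], .cross .virtual q t, [u]⟩, ⟨[], .cross .virtual p t, [q, u]⟩,
    ⟨[t, p], .cross .virtual q u, []⟩, ⟨[t], .cross .virtual p u, [q]⟩]

theorem blockSwap_cross_left (k : Kind) (p q t u : Dir) :
    VEq [p, q, t, u] [t, u, q, p] ([⟨[], .cross k p q, [t, u]⟩] ++ blockSwap q p t u)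
      (blockSwap p q t u ++ [⟨[t, u], .cross k p q, []⟩]) := by
  have s1 := VEq.move (.inr (VRule.triangle_ab k p q t)) []
    [⟨[t, q], .cross .virtual p u, []⟩, ⟨[t], .cross .virtual q u, [p]⟩] [] [u]
    (w := [p, q, t, u]) (w' := [t, u, q, p]) (by simp)
  have s2 := VEq.move (.inr (VRule.triangle_ab k p q u))
    [⟨[p], .cross .virtual q t, [u]⟩, ⟨[], .cross .virtual p t, [q, u]⟩] [] [t] []
    (w := [p, q, t, u]) (w' := [t, u, q, p]) (by simp)
  exact s1.trans s2

theorem blockSwap_cross_right (k : Kind) (p q t u : Dir) :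
    VEq [p, q, t, u] [u, t, p, q] ([⟨[p, q], .cross k t u, []⟩] ++ blockSwap p q u t)
      (blockSwap p q t u ++ [⟨[], .cross k t u, [p, q]⟩]) := by
  have s1 := VEq.move (.inl (IsotopyRule.exchange (.cross .virtual p u) (.cross .virtual q t) []))
    [⟨[p, q], .cross k t u, []⟩, ⟨[p], .cross .virtual q u, [t]⟩]
    [⟨[u], .cross .virtual p t, [q]⟩] [] []
    (w := [p, q, t, u]) (w' := [u, t, p, q]) (by simp)
  have s2 := VEq.move (.inr (VRule.triangle_bc k q t u)) []
    [⟨[], .cross .virtual p u, [t, q]⟩, ⟨[u], .cross .virtual p t, [q]⟩] [p] []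
    (w := [p, q, t, u]) (w' := [u, t, p, q]) (by simp)
  have s3 := VEq.move (.inr (VRule.triangle_bc k p t u))
    [⟨[p], .cross .virtual q t, [u]⟩, ⟨[p, t], .cross .virtual q u, []⟩] [] [] [q]
    (w := [p, q, t, u]) (w' := [u, t, p, q]) (by simp)
  have s4 := VEq.move (.inl (IsotopyRule.exchange (.cross .virtual p t) (.cross .virtual q u) []))
    [⟨[p], .cross .virtual q t, [u]⟩]
    [⟨[t], .cross .virtual p u, [q]⟩, ⟨[], .cross k t u, [p, q]⟩] [] []
    (w := [p, q, t, u]) (w' := [u, t, p, q]) (by simp)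
  exact s1.trans (s2.symm.trans (s3.symm.trans s4.symm))

theorem blockSwap_blockSwap (p q t u : Dir) :
    VEq [p, q, t, u] [p, q, t, u] (blockSwap p q t u ++ blockSwap t u p q) [] := by
  have s1 := VEq.move (.inr (VRule.v2 p u))
    [⟨[p], .cross .virtual q t, [u]⟩, ⟨[], .cross .virtual p t, [q, u]⟩,
      ⟨[t, p], .cross .virtual q u, []⟩]
    [⟨[], .cross .virtual t p, [u, q]⟩, ⟨[p, t], .cross .virtual u q, []⟩,
      ⟨[p], .cross .virtual t q, [u]⟩] [t] [q]
    (w := [p, q, t, u]) (w' := [p, q, t, u]) (by simp)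
  have s2 := VEq.move (.inl (IsotopyRule.exchange (.cross .virtual t p) (.cross .virtual q u) []))
    [⟨[p], .cross .virtual q t, [u]⟩, ⟨[], .cross .virtual p t, [q, u]⟩]
    [⟨[p, t], .cross .virtual u q, []⟩, ⟨[p], .cross .virtual t q, [u]⟩] [] []
    (w := [p, q, t, u]) (w' := [p, q, t, u]) (by simp)
  have s3 := VEq.move (.inr (VRule.v2 p t)) [⟨[p], .cross .virtual q t, [u]⟩]
    [⟨[p, t], .cross .virtual q u, []⟩, ⟨[p, t], .cross .virtual u q, []⟩,
      ⟨[p], .cross .virtual t q, [u]⟩] [] [q, u]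
    (w := [p, q, t, u]) (w' := [p, q, t, u]) (by simp)
  have s4 := VEq.move (.inr (VRule.v2 q u)) [⟨[p], .cross .virtual q t, [u]⟩]
    [⟨[p], .cross .virtual t q, [u]⟩] [p, t] []
    (w := [p, q, t, u]) (w' := [p, q, t, u]) (by simp)
  have s5 := VEq.move (.inr (VRule.v2 q t)) [] [] [p] [u]
    (w := [p, q, t, u]) (w' := [p, q, t, u]) (by simp)
  exact s1.trans (s2.symm.trans (s3.trans (s4.trans s5)))

/-- The double covering diagram of a double point. -/
abbrev doubleCross (k : Kind) (a b : Dir) : List Slice :=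
  [⟨[], .cross k b a, [a, b]⟩, ⟨[a, b], .cross k a b, []⟩]

/-- The double of a bar on the first strand followed by a bar on the second strand. The right-hand
side is also, definitionally, the double of the two bars in the other order. -/
theorem barBlock_barBlock (a b : Dir) :
    VEq [b, a, a, b] [b, a, a, b] (barBlock [] a [b] ++ barBlock [a] b [])
      (doubleCross .virtual a b ++ blockSwap a b b a) := by
  have s1 := (blockSwap_cross_right .virtual b a a b).symm.comp
    (VEq.refl (L := [⟨[b, a], .cross .virtual b a, []⟩]) (w' := [b, a, a, b]) (by simp))
  have c1 : Composable [b, a, a, b] [⟨[b, a], .cross .virtual a b, []⟩] [b, a, b, a] := by simp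
  have s2 := (VEq.refl c1).comp (blockSwap_cross_left .virtual b a b a).symm
  have s3 := VEq.move (.inl (IsotopyRule.exchange (.cross .virtual b a) (.cross .virtual a b) []))
    [] (blockSwap a b b a) [] []
    (w := [b, a, a, b]) (w' := [b, a, a, b]) (by simp [blockSwap])
  exact s1.trans (s2.trans s3.symm)

/-- The double covering diagrams of the two sides of the move T3. -/
theorem barBlock_cross_barBlock (k : Kind) (a b : Dir) :
    VEq [b, a, a, b] [a, b, b, a]
      (barBlock [] a [b] ++ barBlock [a] b [] ++ doubleCross k a b ++ barBlock [] b [a] ++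
        barBlock [b] a [])
      (doubleCross .virtual a b ++ doubleCross k b a ++ doubleCross .virtual a b) := by
  have c0 : Composable [b, a, a, b] (doubleCross .virtual a b) [a, b, b, a] := by simp
  have c1 : Composable [a, b, a, b] [⟨[a, b], .cross k a b, []⟩] [a, b, b, a] := by simp
  have c2 : Composable [a, b, b, a] [⟨[a, b], .cross k b a, []⟩] [a, b, a, b] := by simp
  have c3 : Composable [a, b, a, b] [⟨[], .cross k a b, [a, b]⟩] [b, a, a, b] := by simp
  have c4 : Composable [a, b, b, a] (blockSwap a b b a) [b, a, a, b] := by simp [blockSwap]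
  have cK : Composable [b, a, a, b] (doubleCross k a b) [a, b, b, a] := by simp
  -- The first two bars double to a pair of virtual crossings and a block swap, the last two to a
  -- block swap and a pair of virtual crossings.  The pair of real crossings passes the first block
  -- swap, changing sides, and then the two block swaps cancel.
  have s1 := (((barBlock_barBlock a b).comp (.refl cK)).comp (.refl c4)).comp (.refl c0)
  have s2 := (((VEq.refl c0).comp ((blockSwap_cross_right k a b b a).symm.comp (.refl c1))).comp
    (.refl c4)).comp (.refl c0)
  have s3 := (((VEq.refl c0).comp ((VEq.refl c2).comp (blockSwap_cross_left k a b a b).symm)).comp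
    (.refl c4)).comp (.refl c0)
  have s4 := ((VEq.refl c0).comp ((VEq.refl c2).comp
    ((VEq.refl c3).comp (blockSwap_blockSwap b a a b)))).comp (.refl c0)
  have s5 := VEq.move (.inl (IsotopyRule.exchange (.cross k a b) (.cross k b a) []))
    (doubleCross .virtual a b) (doubleCross .virtual a b) [] []
    (w := [b, a, a, b]) (w' := [a, b, b, a]) (by simp)
  exact s1.trans (s2.trans (s3.trans (s4.trans s5.symm)))

theorem Slice.double_widen (s : Slice) (r : List Dir) :
    (s.widen [] r).double = wide r.reverse r s.double := by
  rcases s with ⟨l, g, q⟩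
  cases g with
  | bar a => exact (wide_barBlock r.reverse r l a q rfl).symm
  | _ => simp [Slice.double]

theorem double_wide (X : List Slice) (r : List Dir) :
    (wide [] r X).flatMap Slice.double = wide r.reverse r (X.flatMap Slice.double) := by
  induction X with
  | nil => rfl
  | cons s X ih =>
    have h := s.double_widen r
    simp only [wide, List.map_cons, List.flatMap_cons, List.map_append] at ih h ⊢
    rw [h, ih]

theorem Cov.of_veq {u v : List Dir} {X Y : List Slice} (cX : Composable u X v)
    (cY : Composable u Y v)
    (h : VEq (u.reverse ++ u) (v.reverse ++ v) (X.flatMap Slice.double) (Y.flatMap Slice.double))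
    (r : List Dir) : Cov (u ++ r) (v ++ r) (wide [] r X) (wide [] r Y) := by
  refine ⟨cX.wide [] r, cY.wide [] r, ?_⟩
  rw [double_wide, double_wide]
  simpa [-wide] using h.widen r.reverse r

/-- A local move is covered by isotopies and V-moves as soon as it is so in a diagram with no
further strands. -/
theorem CovRule.of_veq {u v : List Dir} {X Y : List Slice} (hX : X ≠ []) (cX : Composable u X v)
    (cY : Composable u Y v)
    (h : VEq (u.reverse ++ u) (v.reverse ++ v) (X.flatMap Slice.double) (Y.flatMap Slice.double)) :
    CovRule X Y := by
  refine .of_left (fun _ _ => .all _) (fun _ _ => .all _) fun u' v' r cX' _ => ?_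
  obtain rfl := Composable.dom_unique hX cX cX'
  obtain rfl := cX.cod_unique cX'
  exact .of_veq cX cY h r

theorem TRule.covRule {X Y : List Slice} (h : TRule X Y) : CovRule X Y := by
  cases h with
  | t1_left a b => exact .t1_left a b
  | t1_right a b => exact .t1_right a b
  | t2 a => exact .t2 a
  | t3 k hk a b =>
    refine .of_veq (u := [a, b]) (v := [b, a]) (by simp) (by simp) (by simp) ?_
    have e : k.flip.flip = k := Kind.flip_flip k
    simpa [Slice.double, Gen.mirror, Gen.reflect, Gen.switch, e, Kind.flip_virtual] using
      barBlock_cross_barBlock k a b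

/-- Passing a stack on its right, a piece exchanges its height with all pieces of the stack. -/
theorem Exch.stack {g : Gen} {u v : List Dir} {Y : List Slice} (cY : Composable u Y v)
    (hY : ∀ s ∈ Y, Exch g s.gen) (l r : List Dir) :
    Cov (l ++ g.dom ++ u ++ r) (l ++ g.cod ++ v ++ r)
      ([⟨l, g, u ++ r⟩] ++ wide (l ++ g.cod) r Y) (wide (l ++ g.dom) r Y ++ [⟨l, g, v ++ r⟩]) := by
  induction Y generalizing u with
  | nil =>
    obtain rfl : u = v := cY
    simpa [-Slice.dom, -Slice.cod, -Gen.dom, -Gen.cod] using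
      Cov.refl (Slice.composable l g (u ++ r))
  | cons s Y ih =>
    obtain ⟨rfl, cY⟩ := cY
    have h1 := hY s (by simp) l s.left (s.right ++ r)
    have h2 := ih cY fun t ht => hY t (by simp [ht])
    have c1 := cY.wide (l ++ g.cod) r
    have c2 := Slice.composable (l ++ g.dom ++ s.left) s.gen (s.right ++ r)
    simp only [List.append_assoc, List.cons_append, List.nil_append, Slice.dom, Slice.cod]
      at h1 h2 c1 c2 ⊢
    have e1 := h1.comp (.refl c1)
    have e2 := (Cov.refl c2).comp h2
    simp only [List.cons_append, List.nil_append] at e1 e2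
    simpa [-Slice.dom, -Slice.cod, -Gen.dom, -Gen.cod] using e1.trans e2

theorem CovRule.bar_bar (a b : Dir) (m : List Dir) : CovRule
    [⟨[], .bar a, m ++ [b]⟩, ⟨a :: m, .bar b, []⟩]
    [⟨a :: m, .bar b, []⟩, ⟨[], .bar a, m ++ [b]⟩] := by
  refine .of_left (fun _ _ => .all _) (fun _ _ => .all _) fun u v r cX _ => ?_
  obtain rfl := cX.1
  obtain rfl := cX.2.2
  have hb : ∀ (Y : List Slice), (∀ s ∈ Y, ∀ c, s.gen ≠ .bar c) → ∀ s ∈ Y, Exch (.bar a) s.gen :=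
    fun Y h s hs => .bar_left a (h s hs)
  have x1 := Exch.stack (composable_passLeft [] b m r) (hb _ (barFree_passLeft _ _ _ _)) [] []
  have x2 := Exch.stack (composable_passRight [] b m r) (hb _ (barFree_passRight _ _ _ _)) [] []
  have base := Cov.of_veq (u := [a, b]) (v := [a, b])
    (X := [⟨[], .bar a, [b]⟩, ⟨[a], .bar b, []⟩]) (Y := [⟨[a], .bar b, []⟩, ⟨[], .bar a, [b]⟩])
    (by simp) (by simp) (barBlock_barBlock a b) (m ++ r)
  have cj := Cov.bar_conj [a] m b r
  have c1 := Slice.composable [] (.bar a) (m ++ b :: r)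
  have c2 := composable_passLeft [a] b m r
  have c3 := composable_passRight [a] b m r
  have c4 := Slice.composable [a] (.bar b) (m ++ r)
  rw [wide_passLeft, wide_passLeft] at x1
  rw [wide_passRight, wide_passRight] at x2
  simp only [wide, Slice.widen, List.map_cons, List.map_nil, List.append_assoc, List.cons_append,
    List.nil_append, Gen.dom, Gen.cod, List.append_nil] at x1 x2 base cj c1 c2 c3 c4 ⊢
  have e1 := (Cov.refl c1).comp cj
  have e2 := (x1.comp (.refl c4)).comp (.refl c3)
  have e3 := ((Cov.refl c2).comp base).comp (.refl c3)
  have e4 := ((Cov.refl c2).comp (.refl c4)).comp x2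
  have e5 := cj.comp (.refl c1)
  simp only [List.append_assoc, List.cons_append, List.nil_append] at e1 e2 e3 e4 e5
  simpa using e1.trans (e2.trans (e3.trans (e4.trans e5.symm)))

/-- A bar passes a maximal point: both doubles reduce to the same stack, a virtual crossing below
two maximal points. -/
theorem CovRule.bar_cap (a : Dir) : CovRule
    [⟨[], .bar a, [a.flip]⟩, ⟨[], .cap a, []⟩] [⟨[a], .bar a.flip, []⟩, ⟨[], .cap a, []⟩] := by
  refine .of_veq (u := [a, a.flip]) (v := []) (by simp) (by simp) (by simp) ?_
  obtain ⟨n, hn⟩ : ∃ n, n = a.flip := ⟨_, rfl⟩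
  -- The bar on the left leg: the crossing on the axis slides over the right maximal point.
  have s1 : VEq [n, a, a, n] []
      [⟨[n], .cross .virtual a a, [n]⟩, ⟨[], .cap n, [a, n]⟩, ⟨[], .cap a, []⟩]
      [⟨[n], .cross .virtual a a, [n]⟩, ⟨[n, a], .cap a, []⟩, ⟨[], .cap n, []⟩] := by
    subst hn
    cases a <;>
      exact VEq.move (.inl (IsotopyRule.exchange (.cap _) (.cap _) [])) [_] [] [] []
        (by simp [Dir.flip])
  have s2 : VEq [n, a, a, n] []
      [⟨[n], .cross .virtual a a, [n]⟩, ⟨[n, a], .cap a, []⟩, ⟨[], .cap n, []⟩]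
      [⟨[n, a], .cross .virtual a n, []⟩, ⟨[n], .cap a, [a]⟩, ⟨[], .cap n, []⟩] := by
    subst hn
    cases a <;>
      exact VEq.move (.inl (IsotopyRule.cap_slide .virtual _ _)) [] [_] [_] []
        (by simp [Dir.flip])
  -- The bar on the right leg: the maximal points absorb the last two crossings (V1), and the
  -- crossing on the axis slides over one of them, which cancels a further crossing (V2).
  have t1 : VEq [n, a, a, n] []
      [⟨[], .cross .virtual n a, [a, n]⟩, ⟨[a, n], .cross .virtual a n, []⟩,
        ⟨[a], .cross .virtual n n, [a]⟩, ⟨[], .cross .virtual a n, [n, a]⟩,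
        ⟨[], .cap n, [n, a]⟩, ⟨[], .cross .virtual n a, []⟩, ⟨[], .cap a, []⟩]
      [⟨[], .cross .virtual n a, [a, n]⟩, ⟨[a, n], .cross .virtual a n, []⟩,
        ⟨[a], .cross .virtual n n, [a]⟩, ⟨[], .cross .virtual a n, [n, a]⟩,
        ⟨[n, a], .cross .virtual n a, []⟩, ⟨[], .cap n, [a, n]⟩, ⟨[], .cap a, []⟩] := by
    subst hn
    cases a <;>
      exact VEq.move (.inl (IsotopyRule.exchange (.cap _) (.cross .virtual _ _) []))
        [_, _, _, _] [_] [] [] (by simp [Dir.flip])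
  have t2 : VEq [n, a, a, n] []
      [⟨[], .cross .virtual n a, [a, n]⟩, ⟨[a, n], .cross .virtual a n, []⟩,
        ⟨[a], .cross .virtual n n, [a]⟩, ⟨[], .cross .virtual a n, [n, a]⟩,
        ⟨[], .cap n, [n, a]⟩, ⟨[], .cross .virtual n a, []⟩, ⟨[], .cap a, []⟩]
      [⟨[], .cross .virtual n a, [a, n]⟩, ⟨[a, n], .cross .virtual a n, []⟩,
        ⟨[a], .cross .virtual n n, [a]⟩, ⟨[], .cross .virtual a n, [n, a]⟩,
        ⟨[], .cap n, [n, a]⟩, ⟨[], .cap n, []⟩] := by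
    subst hn
    cases a <;>
      exact VEq.move (.inr (VRule.v1 _)) [_, _, _, _, _] [] [] []
        (by simp [Dir.flip])
  have t3 : VEq [n, a, a, n] []
      [⟨[], .cross .virtual n a, [a, n]⟩, ⟨[a, n], .cross .virtual a n, []⟩,
        ⟨[a], .cross .virtual n n, [a]⟩, ⟨[], .cross .virtual a n, [n, a]⟩,
        ⟨[], .cap n, [n, a]⟩, ⟨[], .cap n, []⟩]
      [⟨[], .cross .virtual n a, [a, n]⟩, ⟨[a, n], .cross .virtual a n, []⟩,
        ⟨[a], .cross .virtual n n, [a]⟩, ⟨[], .cap a, [n, a]⟩, ⟨[], .cap n, []⟩] := by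
    subst hn
    cases a <;>
      exact VEq.move (.inr (VRule.v1 _)) [_, _, _] [_] [] [_, _]
        (by simp [Dir.flip])
  have t4 : VEq [n, a, a, n] []
      [⟨[], .cross .virtual n a, [a, n]⟩, ⟨[a, n], .cross .virtual a n, []⟩,
        ⟨[], .cross .virtual a n, [n, a]⟩, ⟨[n], .cap a, [a]⟩, ⟨[], .cap n, []⟩]
      [⟨[], .cross .virtual n a, [a, n]⟩, ⟨[a, n], .cross .virtual a n, []⟩,
        ⟨[a], .cross .virtual n n, [a]⟩, ⟨[], .cap a, [n, a]⟩, ⟨[], .cap n, []⟩] := by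
    subst hn
    cases a <;>
      exact VEq.move (.inl (IsotopyRule.cap_slide .virtual _ _)) [_, _] [_] [] [_]
        (by simp [Dir.flip])
  have t5 : VEq [n, a, a, n] []
      [⟨[], .cross .virtual n a, [a, n]⟩, ⟨[], .cross .virtual a n, [a, n]⟩,
        ⟨[n, a], .cross .virtual a n, []⟩, ⟨[n], .cap a, [a]⟩, ⟨[], .cap n, []⟩]
      [⟨[], .cross .virtual n a, [a, n]⟩, ⟨[a, n], .cross .virtual a n, []⟩,
        ⟨[], .cross .virtual a n, [n, a]⟩, ⟨[n], .cap a, [a]⟩, ⟨[], .cap n, []⟩] := by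
    subst hn
    cases a <;>
      exact VEq.move (.inl (IsotopyRule.exchange (.cross .virtual _ _) (.cross .virtual _ _) []))
        [_] [_, _] [] [] (by simp [Dir.flip])
  have t6 : VEq [n, a, a, n] []
      [⟨[], .cross .virtual n a, [a, n]⟩, ⟨[], .cross .virtual a n, [a, n]⟩,
        ⟨[n, a], .cross .virtual a n, []⟩, ⟨[n], .cap a, [a]⟩, ⟨[], .cap n, []⟩]
      [⟨[n, a], .cross .virtual a n, []⟩, ⟨[n], .cap a, [a]⟩, ⟨[], .cap n, []⟩] := by
    subst hn
    cases a <;>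
      exact VEq.move (.inr (VRule.v2 _ _)) [] [_, _, _] [] [_, _]
        (by simp [Dir.flip])
  have e := (s1.trans s2).trans
    (t6.symm.trans (t5.trans (t4.trans (t3.symm.trans (t2.symm.trans t1)))))
  subst hn
  cases a <;> exact e

end

/-! ### Bars at minimal points and the proof of the theorem -/

section

attribute [local simp] Composable Slice.dom Slice.cod Gen.dom Gen.cod Dir.flip_flip

theorem CovRule.of_exch {g g' : Gen} (h : Exch g g') (m : List Dir) : CovRule
    [⟨[], g, m ++ g'.dom⟩, ⟨g.cod ++ m, g', []⟩] [⟨g.dom ++ m, g', []⟩, ⟨[], g, m ++ g'.cod⟩] := by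
  intro u v l r cX _
  obtain rfl := cX.1
  obtain rfl := cX.2.2
  simpa [wide, Slice.widen, -Gen.dom, -Gen.cod] using h l m r

theorem CovRule.exchange (g g' : Gen) (m : List Dir) : CovRule
    [⟨[], g, m ++ g'.dom⟩, ⟨g.cod ++ m, g', []⟩]
    [⟨g.dom ++ m, g', []⟩, ⟨[], g, m ++ g'.cod⟩] := by
  by_cases hg : ∀ a, g ≠ .bar a
  · by_cases hg' : ∀ a, g' ≠ .bar a
    · exact .of_exch (.of_noBar hg hg') m
    · push Not at hg'
      obtain ⟨b, rfl⟩ := hg'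
      exact .of_exch (.bar_right hg b) m
  · push Not at hg
    obtain ⟨a, rfl⟩ := hg
    by_cases hg' : ∀ b, g' ≠ .bar b
    · exact .of_exch (.bar_left a hg') m
    · push Not at hg'
      obtain ⟨b, rfl⟩ := hg'
      exact .bar_bar a b m

/-- An isotopy event whose covering is known, inside a larger stack. -/
theorem Cov.isotopy {X Y : List Slice} (h : IsotopyRule X Y) (h' : CovRule X Y) (P Q : List Slice)
    (l r : List Dir) {w w' : List Dir} (hc : Composable w (P ++ wide l r X ++ Q) w') :
    Cov w w' (P ++ wide l r X ++ Q) (P ++ wide l r Y ++ Q) := by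
  obtain ⟨hX, u, v, cX, cY⟩ := h.wellTyped
  exact (h' u v l r cX cY).context (by simpa using hX) hc

theorem CovRule.bar_cup (a : Dir) : CovRule
    [⟨[], .cup a, []⟩, ⟨[], .bar a, [a.flip]⟩] [⟨[], .cup a, []⟩, ⟨[a], .bar a.flip, []⟩] := by
  refine .of_left (fun _ _ => .all _) (fun _ _ => .all _) fun u v r cX _ => ?_
  obtain rfl := cX.1
  obtain rfl := cX.2.2
  obtain ⟨n, hn⟩ : ∃ n, n = a.flip := ⟨_, rfl⟩
  -- A zigzag is inserted above the bar on the right leg; the bar runs along it.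
  have s1 : Cov r (a :: n :: r)
      [⟨[], .cup a, r⟩, ⟨[a], .bar n, r⟩, ⟨[a, n], .cup a, r⟩, ⟨[a], .cap n, n :: r⟩]
      [⟨[], .cup a, r⟩, ⟨[a], .bar n, r⟩] := by
    subst hn
    cases a <;>
      exact .isotopy (.zigzag_left _) (.of_rule (.inl (.zigzag_left _)) (by simp [NoBar]))
        [_, _] [] [_] r (by simp [wide, Slice.widen, Dir.flip])
  have s2 : Cov r (a :: n :: r)
      [⟨[], .cup a, r⟩, ⟨[a], .bar n, r⟩, ⟨[a, n], .cup a, r⟩, ⟨[a], .cap n, n :: r⟩]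
      [⟨[], .cup a, r⟩, ⟨[a, n], .cup a, r⟩, ⟨[a], .bar n, a :: n :: r⟩,
        ⟨[a], .cap n, n :: r⟩] := by
    subst hn
    cases a <;>
      exact .isotopy (.exchange (.bar _) (.cup _) []) (.exchange _ _ _) [_] [_] [_] r
        (by simp [wide, Slice.widen, Dir.flip])
  have s3 : Cov r (a :: n :: r)
      [⟨[], .cup a, r⟩, ⟨[a, n], .cup a, r⟩, ⟨[a], .bar n, a :: n :: r⟩, ⟨[a], .cap n, n :: r⟩]
      [⟨[], .cup a, r⟩, ⟨[a, n], .cup a, r⟩, ⟨[a, n], .bar a, n :: r⟩, ⟨[a], .cap n, n :: r⟩] := by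
    subst hn
    cases a <;>
      exact .isotopy (.bar_cap _) (.bar_cap _) [_, _] [] [_] (_ :: r)
        (by simp [wide, Slice.widen, Dir.flip])
  have s4 : Cov r (a :: n :: r)
      [⟨[], .cup a, r⟩, ⟨[a, n], .cup a, r⟩, ⟨[a, n], .bar a, n :: r⟩, ⟨[a], .cap n, n :: r⟩]
      [⟨[], .cup a, r⟩, ⟨[], .cup a, a :: n :: r⟩, ⟨[a, n], .bar a, n :: r⟩,
        ⟨[a], .cap n, n :: r⟩] := by
    subst hn
    cases a <;>
      exact .isotopy (.exchange (.cup _) (.cup _) []) (.exchange _ _ _) [] [_, _] [] r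
        (by simp [wide, Slice.widen, Dir.flip])
  have s5 : Cov r (a :: n :: r)
      [⟨[], .cup a, r⟩, ⟨[], .cup a, a :: n :: r⟩, ⟨[a, n], .bar a, n :: r⟩, ⟨[a], .cap n, n :: r⟩]
      [⟨[], .cup a, r⟩, ⟨[], .bar a, n :: r⟩, ⟨[], .cup a, a :: n :: r⟩,
        ⟨[a], .cap n, n :: r⟩] := by
    subst hn
    cases a <;>
      exact .isotopy (.exchange (.cup _) (.bar _) []) (.exchange _ _ _) [_] [_] [] (_ :: r)
        (by simp [wide, Slice.widen, Dir.flip])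
  have s6 : Cov r (a :: n :: r)
      [⟨[], .cup a, r⟩, ⟨[], .bar a, n :: r⟩, ⟨[], .cup a, a :: n :: r⟩, ⟨[a], .cap n, n :: r⟩]
      [⟨[], .cup a, r⟩, ⟨[], .bar a, n :: r⟩] := by
    subst hn
    cases a <;>
      exact .isotopy (.zigzag_right _) (.of_rule (.inl (.zigzag_right _)) (by simp [NoBar]))
        [_, _] [] [] (_ :: r) (by simp [wide, Slice.widen, Dir.flip])
  subst hn
  exact s6.symm.trans (s5.symm.trans (s4.symm.trans (s3.symm.trans (s2.symm.trans s1))))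

theorem IsotopyRule.covRule {X Y : List Slice} (h : IsotopyRule X Y) : CovRule X Y := by
  cases h with
  | exchange g g' m => exact .exchange g g' m
  | zigzag_left a => exact .of_rule (.inl (.zigzag_left a)) (by simp [NoBar])
  | zigzag_right a => exact .of_rule (.inl (.zigzag_right a)) (by simp [NoBar])
  | cap_slide k a b => exact .of_rule (.inl (.cap_slide k a b)) (by simp [NoBar])
  | cup_slide k a b => exact .of_rule (.inl (.cup_slide k a b)) (by simp [NoBar])
  | bar_cap a => exact .bar_cap a
  | bar_cup a => exact .bar_cup a

end

/-- A local move that is covered in all contexts relates the double covering diagrams by isotopies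
and V-moves. -/
theorem Step.vRelated_double {rule : List Slice → List Slice → Prop}
    (ht : ∀ {X Y}, rule X Y → WellTyped X Y) (hc : ∀ {X Y}, rule X Y → CovRule X Y)
    {D D' : Diagram} (h : Step rule D D') : VRelated D.double D'.double := by
  obtain ⟨P, Q, X, Y, l, r, h, hD, hD'⟩ := h
  obtain ⟨hX, u, v, cX, cY⟩ := ht h
  have cD := D.closed
  rw [hD] at cD
  obtain ⟨cP, cQ⟩ := Composable.split (by simpa using hX) (cX.wide l r) cD
  refine (hc h u v l r cX cY).veq.vRelated (composable_double cP) (composable_double cQ) ?_ ?_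
  · simp [Diagram.double, hD, wide]
  · simp [Diagram.double, hD', wide]

theorem eqvGen_map {α β : Type*} {p : α → α → Prop} {q : β → β → Prop} (f : α → β)
    (hf : ∀ a b, p a b → Relation.EqvGen q (f a) (f b)) {a b : α} (h : Relation.EqvGen p a b) :
    Relation.EqvGen q (f a) (f b) := by
  induction h with
  | rel _ _ h => exact hf _ _ h
  | refl _ => exact .refl _
  | symm _ _ _ ih => exact .symm _ _ ih
  | trans _ _ _ _ _ ih ih' => exact .trans _ _ _ ih ih'

/-- Diagrams related by isotopies, V-moves and T-moves have double covering diagrams related by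
isotopies and V-moves. -/
theorem VTRelated.double {D D' : Diagram} (h : VTRelated D D') : VRelated D.double D'.double := by
  refine eqvGen_map Diagram.double (fun D D' h => ?_) h
  rcases h with h | h | h
  · exact h.vRelated_double (·.wellTyped) (·.covRule)
  · exact h.vRelated_double (·.wellTyped) (·.covRule)
  · exact h.vRelated_double (·.wellTyped) (·.covRule)

theorem Isotopic.vtRelated {D D' : Diagram} (h : Isotopic D D') : VTRelated D D' :=
  eqvGen_map id (fun _ _ h => .rel _ _ (.inl h)) h

theorem VirtualIsotopic.vRelated {E E' : VirtualDiagram} (h : VirtualIsotopic E E') :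
    VRelated E E' :=
  eqvGen_map id (fun _ _ h => .rel _ _ (.inl h)) h

theorem VRelated.virtualEquiv {E E' : VirtualDiagram} (h : VRelated E E') : VirtualEquiv E E' :=
  eqvGen_map id (fun _ _ h => .rel _ _ (h.imp_right .inr)) h

theorem RMove.virtualEquiv {E E' : VirtualDiagram} (h : RMove E.1 E'.1) : VirtualEquiv E E' :=
  h.elim (fun h => .rel _ _ (.inr (.inl h))) fun h => .symm _ _ (.rel _ _ (.inr (.inl h)))

theorem RMove.symm {D D' : Diagram} (h : RMove D D') : RMove D' D := Or.symm h

/-- A double covering diagram of `D` is related to the one constructed from `D` by isotopies and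
V-moves. -/
theorem IsDoubleCoveringDiagram.vRelated {D : Diagram} {E : VirtualDiagram}
    (h : IsDoubleCoveringDiagram D E) : VRelated E D.double := by
  obtain ⟨D₁, h, h'⟩ := h
  exact .trans _ _ _ h'.vRelated (.symm _ _ h.vtRelated.double)

theorem RRule.noBar {X Y : List Slice} (h : RRule X Y) : NoBar X ∧ NoBar Y := by
  cases h <;> simp [NoBar, triangleLeft, triangleRight]

/-- A Reidemeister move on `D` is covered by two: one on the mirror image and one on `D`. -/
theorem Step.rMove_double {D D' : Diagram} (h : Step RRule D D') :
    ∃ F₁ F₂ F₃ : VirtualDiagram, VRelated D.double F₁ ∧ RMove F₁.1 F₂.1 ∧ RMove F₂.1 F₃.1 ∧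
      VRelated F₃ D'.double := by
  obtain ⟨P, Q, X, Y, l, r, h, hD, hD'⟩ := h
  obtain ⟨hX, u, v, cX, cY⟩ := h.wellTyped
  have cD := D.closed
  rw [hD] at cD
  obtain ⟨cP, cQ⟩ := Composable.split (by simpa using hX) (cX.wide l r) cD
  have cP := composable_double cP
  have cQ := composable_double cQ
  have bP : NoBar (P.flatMap Slice.double) := fun s hs => by
    obtain ⟨t, -, ht⟩ := List.mem_flatMap.1 hs
    exact t.barFree_double s ht
  have bQ : NoBar (Q.flatMap Slice.double) := fun s hs => by
    obtain ⟨t, -, ht⟩ := List.mem_flatMap.1 hs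
    exact t.barFree_double s ht
  -- Isotopies separate the mirror image of the move from the move itself.
  have key : ∀ {Z : List Slice}, NoBar Z → Composable u Z v →
      VEq ((l ++ u ++ r).reverse ++ (l ++ u ++ r)) ((l ++ v ++ r).reverse ++ (l ++ v ++ r))
        ((wide l r Z).flatMap Slice.double)
        (wide r.reverse (l.reverse ++ (l ++ u ++ r)) (mirrorStack Z) ++
          wide ((l ++ v ++ r).reverse ++ l) r Z) := by
    intro Z hb c
    have e := double_of_noBar (noBar_wide.2 hb) (c.wide l r)
    rwa [mirrorStack_wide, wide_wide, wide_wide, List.nil_append, List.append_nil] at e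
  have cA : ∀ {Z : List Slice}, Composable u Z v →
      Composable ((l ++ u ++ r).reverse ++ (l ++ u ++ r))
        (wide r.reverse (l.reverse ++ (l ++ u ++ r)) (mirrorStack Z))
        ((l ++ v ++ r).reverse ++ (l ++ u ++ r)) := fun c => by
    simpa using c.mirror.wide r.reverse (l.reverse ++ (l ++ u ++ r))
  have cB : ∀ {Z : List Slice}, Composable u Z v →
      Composable ((l ++ v ++ r).reverse ++ (l ++ u ++ r)) (wide ((l ++ v ++ r).reverse ++ l) r Z)
        ((l ++ v ++ r).reverse ++ (l ++ v ++ r)) := fun c => by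
    simpa using c.wide ((l ++ v ++ r).reverse ++ l) r
  have bM : ∀ {Z : List Slice}, NoBar Z → NoBar (mirrorStack Z) := by
    intro Z hb s hs c e
    obtain ⟨t, ht, rfl⟩ := List.mem_map.1 hs
    rcases t with ⟨p, g, q⟩
    cases g <;> simp_all [Slice.mirror, Gen.mirror, Gen.reflect, Gen.switch]
    exact hb _ ht _ rfl
  have make : ∀ {A B : List Slice}, NoBar A → NoBar B → Composable u A v → Composable u B v →
      ∃ F : VirtualDiagram, F.1.slices = P.flatMap Slice.double ++
        (wide r.reverse (l.reverse ++ (l ++ u ++ r)) (mirrorStack A) ++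
          wide ((l ++ v ++ r).reverse ++ l) r B) ++ Q.flatMap Slice.double := by
    intro A B bA bB hA hB
    refine ⟨⟨⟨_, (cP.append ((cA hA).append (cB hB))).append cQ⟩, ?_⟩, rfl⟩
    change NoBar _
    rw [noBar_append, noBar_append, noBar_append, noBar_wide, noBar_wide]
    exact ⟨⟨bP, bM bA, bB⟩, bQ⟩
  obtain ⟨F₁, h₁⟩ := make h.noBar.1 h.noBar.1 cX cX
  obtain ⟨F₂, h₂⟩ := make h.noBar.2 h.noBar.1 cY cX
  obtain ⟨F₃, h₃⟩ := make h.noBar.2 h.noBar.2 cY cY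
  refine ⟨F₁, F₂, F₃, ?_, ?_, ?_, ?_⟩
  · exact (key h.noBar.1 cX).vRelated cP cQ (by simp [Diagram.double, hD, wide]) h₁
  · have aux : ∀ {A B : List Slice} {F G : VirtualDiagram}, RRule (mirrorStack A) (mirrorStack B) →
        F.1.slices = P.flatMap Slice.double ++
          (wide r.reverse (l.reverse ++ (l ++ u ++ r)) (mirrorStack A) ++
            wide ((l ++ v ++ r).reverse ++ l) r X) ++ Q.flatMap Slice.double →
        G.1.slices = P.flatMap Slice.double ++
          (wide r.reverse (l.reverse ++ (l ++ u ++ r)) (mirrorStack B) ++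
            wide ((l ++ v ++ r).reverse ++ l) r X) ++ Q.flatMap Slice.double →
        Step RRule F.1 G.1 := fun h hF hG =>
      ⟨_, wide ((l ++ v ++ r).reverse ++ l) r X ++ Q.flatMap Slice.double, _, _, _, _, h,
        by simpa only [List.append_assoc] using hF, by simpa only [List.append_assoc] using hG⟩
    exact h.mirror.imp (fun h => aux h h₁ h₂) fun h => aux h h₂ h₁
  · exact .inl ⟨_, _, X, Y, _, _, h, by rw [h₂, ← List.append_assoc], by
      rw [h₃, ← List.append_assoc]⟩
  · exact .symm _ _ ((key h.noBar.2 cY).vRelated cP cQ (by simp [Diagram.double, hD', wide]) h₃)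

theorem RMove.double {D D' : Diagram} (h : RMove D D') :
    ∃ F₁ F₂ F₃ : VirtualDiagram, VRelated D.double F₁ ∧ RMove F₁.1 F₂.1 ∧ RMove F₂.1 F₃.1 ∧
      VRelated F₃ D'.double := by
  rcases h with h | h
  · exact h.rMove_double
  · obtain ⟨F₁, F₂, F₃, h₁, h₂, h₃, h₄⟩ := h.rMove_double
    exact ⟨F₃, F₂, F₁, .symm _ _ h₄, h₃.symm, h₂.symm, .symm _ _ h₁⟩

theorem TwistedEquiv.double {D D' : Diagram} (h : TwistedEquiv D D') :
    VirtualEquiv D.double D'.double := by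
  refine eqvGen_map Diagram.double (fun D D' h => ?_) h
  have vt : VTRelated D D' → VirtualEquiv D.double D'.double := fun h => h.double.virtualEquiv
  rcases h with h | h | h | h
  · exact vt (.rel _ _ (.inl h))
  · obtain ⟨F₁, F₂, F₃, h₁, h₂, h₃, h₄⟩ := RMove.double (.inl h)
    exact .trans _ _ _ h₁.virtualEquiv
      (.trans _ _ _ h₂.virtualEquiv (.trans _ _ _ h₃.virtualEquiv h₄.virtualEquiv))
  · exact vt (.rel _ _ (.inr (.inl h)))
  · exact vt (.rel _ _ (.inr (.inr h)))

end TwistedLink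

/-- Double covering diagrams of equivalent twisted link diagrams are equivalent as virtual links;
isotopies, V-moves and T-moves are covered by isotopies and V-moves, and an R-move is covered, up to
isotopies and V-moves, by a pair of R-moves. -/
theorem mainTheorem3 (D D' : TwistedLink.Diagram) (E E' : TwistedLink.VirtualDiagram)
    (hE : TwistedLink.IsDoubleCoveringDiagram D E)
    (hE' : TwistedLink.IsDoubleCoveringDiagram D' E') :
    (TwistedLink.TwistedEquiv D D' → TwistedLink.VirtualEquiv E E') ∧
    (TwistedLink.VTRelated D D' → TwistedLink.VRelated E E') ∧
    (TwistedLink.RMove D D' → ∃ F₁ F₂ F₃ : TwistedLink.VirtualDiagram,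
      TwistedLink.VRelated E F₁ ∧ TwistedLink.RMove F₁.1 F₂.1 ∧
        TwistedLink.RMove F₂.1 F₃.1 ∧ TwistedLink.VRelated F₃ E') := by
  have e := hE.vRelated
  have e' : TwistedLink.VRelated D'.double E' := .symm _ _ hE'.vRelated
  refine ⟨fun h => ?_, fun h => ?_, fun h => ?_⟩
  · exact .trans _ _ _ e.virtualEquiv (.trans _ _ _ h.double e'.virtualEquiv)
  · exact .trans _ _ _ e (.trans _ _ _ h.double e')
  · obtain ⟨F₁, F₂, F₃, h₁, h₂, h₃, h₄⟩ := h.double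
    exact ⟨F₁, F₂, F₃, .trans _ _ _ e h₁, h₂, h₃, .trans _ _ _ h₄ e'⟩
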